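/- Let $m,n\ge 1$ be integers. Let $M$ be the $m\times n$ Möbius strip, i.e. the quotient of the rectangle $[0,m]\times[0,n]$ by $(x,0)\sim(m-x,n)$ for $x\in[0,m]$, tiled by $mn$ unit squares, and let $p_M\colon S=[0,m]\times\mathbb R\to M$ be the covering map sending $(x,y)$ to the class of $(x,\,y-kn)$ if $k=\lfloor y/n\rfloor$ is even and to the class of $(m-x,\,y-kn)$ if $k$ is odd. Let $\mathcal S_m$ be the graph whose vertices are the pairs $(a,b)$ of integers with $0\le a<m$, where $(a,b)$ and $(a+c,b+d)$ are joined by an edge when $\{|c|,|d|\}=\{1,2\}$; map $(a,b)$ to the point $(a+\tfrac12,b+\tfrac12)$ of $S$ and each edge to the straight line segment between the images of its ends. The Möbius strip knight graph $\mathcal M_{m,n}$ is the quotient of $\mathcal S_m$ by the group generated by the glide reflection $(a,b)\mapsto(m-1-a,\,b+n)$. It is a multigraph (possibly with loops), its vertices are the $mn$ squares $(a,b)$ with $0\le a<m$, $0\le b<n$, and it maps to $M$ through $p_M$. A knight's tour on $\mathcal M_{m,n}$ is a Hamiltonian cycle, i.e. a closed edge path, starting and ending at $(0,0)$, that visits every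 vertex exactly once (apart from the return to $(0,0)$) and uses no edge more than once; if $m=n=1$, the trivial path at the only vertex is a knight's tour. A knight's tour is nullhomotopic if the loop in $M$ that it defines is the identity of $\pi_1(M,v)$, where $v$ is the class of $(\tfrac12,\tfrac12)$. **Theorem.** $\mathcal M_{m,n}$ has a nullhomotopic knight's tour if and only if none of the following holds: - $m$ and $n$ are both odd and at least one of them is greater than $1$; - $m=1$ and $n>1$; - $m=2$; - $m=3$ and $n=4$; - $m=4$ and $n$ is odd. -/

import Mathlib

namespace MobiusKnight

noncomputable section

/-! ### The knight graph of the infinite strip and of the Möbius strip -/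

/-- A unit square `(a, b)` of the tiled infinite vertical strip of width `m`: `0 ≤ a < m` and `b` is
any integer. Its centre is `(a + 1/2, b + 1/2)`. -/
abbrev StripSquare (m : ℕ) : Type := Fin m × ℤ

/-- The knight graph of the infinite strip: `(a, b)` and `(a + c, b + d)` are joined
when `{|c|, |d|} = {1, 2}`. -/
def stripGraph (m : ℕ) : SimpleGraph (StripSquare m) where
  Adj p q :=
    (|(q.1 : ℤ) - p.1| = 1 ∧ |q.2 - p.2| = 2) ∨ (|(q.1 : ℤ) - p.1| = 2 ∧ |q.2 - p.2| = 1)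
  symm := ⟨fun p q h => by
    rw [abs_sub_comm (p.1 : ℤ), abs_sub_comm p.2]; exact h⟩
  loopless := ⟨fun p h => by simp at h⟩

/-- A unit square `(a, b)`, `0 ≤ a < m`, `0 ≤ b < n`, of the `m × n` board. -/
@[ext] structure Square (m n : ℕ) : Type where
  col : Fin m
  row : Fin n

variable {m n : ℕ}

/-- The square `(a, b)` of the board, regarded as a square of the strip. -/
def Square.lift (u : Square m n) : StripSquare m := (u.col, (u.row : ℤ))

/-- The deck transformations of the strip over the Möbius strip, acting on squares: the `k`-th power
of the glide reflection `(a, b) ↦ (m - 1 - a, b + n)`. -/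
def shift (n : ℕ) (k : ℤ) (p : StripSquare m) : StripSquare m :=
  (if Even k then p.1 else p.1.rev, p.2 + k * n)

/-- The covering map from squares of the strip to squares of the Möbius board: the row is reduced
modulo `n`, and the column is reflected, `a ↦ m - 1 - a`, when `⌊b / n⌋` is odd. -/
def proj [NeZero n] (p : StripSquare m) : Square m n where
  col := if Even (p.2 / (n : ℤ)) then p.1 else p.1.rev
  row := ⟨(p.2 % (n : ℤ)).toNat, by
    have hn : (0 : ℤ) < n := by exact_mod_cast Nat.pos_of_ne_zero (NeZero.ne n)
    have h1 := Int.emod_nonneg p.2 hn.ne'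
    have h2 := Int.emod_lt_of_pos p.2 hn
    omega⟩

theorem lift_proj [NeZero n] (p : StripSquare m) :
    (proj p : Square m n).lift = shift n (-(p.2 / (n : ℤ))) p := by
  have hn : (0 : ℤ) < n := by exact_mod_cast Nat.pos_of_ne_zero (NeZero.ne n)
  have h1 := Int.emod_nonneg p.2 hn.ne'
  have h2 := Int.emod_add_mul_ediv p.2 n
  ext
  · simp [Square.lift, proj, shift]
  · simp only [Square.lift, proj, shift]
    rw [Int.toNat_of_nonneg h1]
    linarith [mul_comm (n : ℤ) (p.2 / n)]

theorem proj_lift [NeZero n] (u : Square m n) : proj u.lift = u := by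
  have h1 : ((u.row : ℕ) : ℤ) / (n : ℤ) = 0 :=
    Int.ediv_eq_zero_of_lt (by positivity) (by exact_mod_cast u.row.2)
  have h2 : ((u.row : ℕ) : ℤ) % (n : ℤ) = u.row :=
    Int.emod_eq_of_lt (by positivity) (by exact_mod_cast u.row.2)
  ext <;> simp [proj, Square.lift, h1, h2]

theorem shift_shift (k l : ℤ) (p : StripSquare m) : shift n k (shift n l p) = shift n (k + l) p := by
  by_cases hk : Even k <;> by_cases hl : Even l <;> ext <;>
    simp [shift, hk, hl, Int.even_add] <;> ring

theorem shift_zero (p : StripSquare m) : shift n 0 p = p := by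
  ext <;> simp [shift]

theorem proj_shift [NeZero n] (k : ℤ) (p : StripSquare m) :
    (proj (shift n k p) : Square m n) = proj p := by
  have hn : (n : ℤ) ≠ 0 := by exact_mod_cast NeZero.ne n
  have h1 : (p.2 + k * n) / (n : ℤ) = p.2 / n + k := Int.add_mul_ediv_right _ _ hn
  have h2 : (p.2 + k * n) % (n : ℤ) = p.2 % n := Int.add_mul_emod_self_right _ _ _
  by_cases hk : Even k <;> by_cases hl : Even (p.2 / (n : ℤ)) <;> ext <;>
    simp [proj, shift, h1, h2, hk, hl, Int.even_add]

theorem adj_shift {k : ℤ} {p q : StripSquare m} (h : (stripGraph m).Adj p q) :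
    (stripGraph m).Adj (shift n k p) (shift n k q) := by
  by_cases hk : Even k
  · simpa [stripGraph, shift, hk] using h
  · have e : ((q.1.rev : Fin m) : ℤ) - (p.1.rev : Fin m) = -((q.1 : ℤ) - p.1) := by
      have := q.1.2
      have := p.1.2
      simp only [Fin.val_rev]
      omega
    simp only [stripGraph, shift, hk, if_false, e, abs_neg, add_sub_add_right_eq_sub] at h ⊢
    exact h

/-- A (directed) knight move from `u` to `v` on the Möbius board: a knight move in the strip that
starts at the square `u` itself and ends at a square `dest` lying over `v`. Different moves from `u`
to `v` are different, so the graph may have multiple edges. -/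
@[ext] structure Move [NeZero n] (u v : Square m n) : Type where
  dest : StripSquare m
  adj : (stripGraph m).Adj u.lift dest
  proj_dest : proj dest = v

/-- The `m × n` Möbius strip knight graph, as the quiver of its directed edges. Together with
`Quiver.reverse` below this is the multigraph whose edges are the pairs `{e, reverse e}`. -/
instance [NeZero n] : Quiver (Square m n) where
  Hom u v := Move u v

/-- The same move made backwards: translate the move by the deck transformation that makes it
end in the square `v` itself, and exchange its ends. -/
def Move.reverse [NeZero n] {u v : Square m n} (e : Move u v) : Move v u where
  dest := shift n (-(e.dest.2 / (n : ℤ))) u.lift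
  adj := by
    have h := adj_shift (n := n) (k := -(e.dest.2 / (n : ℤ))) e.adj.symm
    rwa [← lift_proj, e.proj_dest] at h
  proj_dest := by rw [proj_shift, proj_lift]

theorem Move.reverse_reverse [NeZero n] {u v : Square m n} (e : Move u v) :
    e.reverse.reverse = e := by
  have hn : (n : ℤ) ≠ 0 := by exact_mod_cast NeZero.ne n
  have hu : (u.lift.2) / (n : ℤ) = 0 :=
    Int.ediv_eq_zero_of_lt (by simp [Square.lift]) (by simp [Square.lift])
  have h1 : (u.lift.2 + -(e.dest.2 / (n : ℤ)) * n) / (n : ℤ) = -(e.dest.2 / (n : ℤ)) := by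
    rw [Int.add_mul_ediv_right _ _ hn, hu, zero_add]
  have h2 : v.lift = shift n (-(e.dest.2 / (n : ℤ))) e.dest := by
    rw [← lift_proj, e.proj_dest]
  apply Move.ext
  change shift n (-((u.lift.2 + -(e.dest.2 / (n : ℤ)) * n) / (n : ℤ))) v.lift = e.dest
  rw [h1, h2, shift_shift, neg_neg, add_neg_cancel, shift_zero]

instance [NeZero n] : Quiver.HasInvolutiveReverse (Square m n) where
  reverse' e := Move.reverse e
  inv' e := Move.reverse_reverse e

/-- The directed edges traversed by a path, in order. -/
def darts [NeZero n] {u : Square m n} :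
    ∀ {v : Square m n}, Quiver.Path u v → List (Quiver.Total (Square m n))
  | _, .nil => []
  | _, .cons p e => darts p ++ [⟨_, _, e⟩]

/-- Two directed edges are the same undirected edge. -/
def SameEdge [NeZero n] (e f : Quiver.Total (Square m n)) : Prop :=
  f = e ∨ f = ⟨e.right, e.left, Quiver.reverse e.hom⟩

/-- A knight's tour based at `u`: a Hamiltonian cycle of the Möbius strip knight graph, regarded as a
closed path from `u` to `u`. It meets every square, it meets no square twice (except that its last
vertex is its first), and it uses no edge twice. On a board with a single square the trivial path is
a tour. -/
structure IsKnightsTour [NeZero n] {u : Square m n} (p : Quiver.Path u u) : Prop where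
  mem_vertices : ∀ v : Square m n, v ∈ p.vertices
  nodup_vertices : p.vertices.tail.Nodup
  edges_distinct : (darts p).Pairwise fun e f => ¬ SameEdge e f

/-- The base square `(0, 0)`. -/
def baseSquare (m n : ℕ) [NeZero m] [NeZero n] : Square m n := ⟨0, 0⟩

/-! ### The Möbius strip as a topological space -/

/-- The rectangle `[0, m] × [0, n]`. -/
abbrev Rectangle (m n : ℕ) : Type := Set.Icc (0 : ℝ) m × Set.Icc (0 : ℝ) n

/-- The gluing `(x, 0) ∼ (m - x, n)`. -/
def Glue (p q : Rectangle m n) : Prop :=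
  (p.2 : ℝ) = 0 ∧ (q.2 : ℝ) = n ∧ (q.1 : ℝ) = m - p.1

/-- The `m × n` Möbius strip: the quotient of `[0, m] × [0, n]` by the equivalence relation generated
by `(x, 0) ∼ (m - x, n)`. -/
def MobiusStrip (m n : ℕ) : Type := Quot (Glue (m := m) (n := n))

instance : TopologicalSpace (MobiusStrip m n) :=
  inferInstanceAs (TopologicalSpace (Quot Glue))

/-- The quotient map from the rectangle to the Möbius strip. -/
def toMobius (p : Rectangle m n) : MobiusStrip m n := Quot.mk _ p

theorem continuous_toMobius : Continuous (toMobius : Rectangle m n → MobiusStrip m n) :=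
  continuous_quot_mk

/-- The infinite strip `[0, m] × ℝ`. -/
abbrev Strip (m : ℕ) : Type := Set.Icc (0 : ℝ) m × ℝ

/-- The reflection `x ↦ m - x` of `[0, m]`. -/
def reflect (x : Set.Icc (0 : ℝ) m) : Set.Icc (0 : ℝ) m :=
  ⟨m - x, by have := x.2.1; have := x.2.2; constructor <;> linarith⟩

theorem continuous_reflect : Continuous (reflect : Set.Icc (0 : ℝ) m → Set.Icc (0 : ℝ) m) := by
  unfold reflect
  fun_prop

/-- The covering map from the strip to the Möbius strip: `(x, y)` goes to the class of
`(x, y - k n)` or `(m - x, y - k n)` as `k = ⌊y / n⌋` is even or odd. -/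
def cover [NeZero n] (p : Strip m) : MobiusStrip m n :=
  toMobius (if Even ⌊p.2 / n⌋ then p.1 else reflect p.1, ⟨p.2 - ⌊p.2 / n⌋ * n, by
    have hn : (0 : ℝ) < n := by exact_mod_cast Nat.pos_of_ne_zero (NeZero.ne n)
    have h1 := (le_div_iff₀ hn).1 (Int.floor_le (p.2 / n))
    have h2 := (div_lt_iff₀ hn).1 (Int.lt_floor_add_one (p.2 / n))
    constructor <;> linarith⟩)

theorem cover_eq [NeZero n] (p : Strip m) (k : ℤ)
    (h : p.2 - k * n ∈ Set.Icc (0 : ℝ) n) :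
    (cover p : MobiusStrip m n) = toMobius (if Even k then p.1 else reflect p.1, ⟨p.2 - k * n, h⟩) := by
  have hn : (0 : ℝ) < n := by exact_mod_cast Nat.pos_of_ne_zero (NeZero.ne n)
  obtain ⟨h0, h1⟩ := h
  rcases h1.lt_or_eq with h1 | h1
  · have hk : ⌊p.2 / n⌋ = k := by
      rw [Int.floor_eq_iff, le_div_iff₀ hn, div_lt_iff₀ hn]
      constructor <;> linarith
    subst hk
    rfl
  · have hk : ⌊p.2 / n⌋ = k + 1 := by
      rw [Int.floor_eq_iff, le_div_iff₀ hn, div_lt_iff₀ hn]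
      push_cast
      constructor <;> linarith
    refine Quot.sound ⟨?_, h1, ?_⟩
    · simp only [hk]
      push_cast
      linarith
    · simp only [hk, Int.even_add_one]
      by_cases hk' : Even k <;> simp [hk', reflect]

theorem continuous_cover [NeZero n] : Continuous (cover : Strip m → MobiusStrip m n) := by
  have hn : (0 : ℝ) < n := by exact_mod_cast Nat.pos_of_ne_zero (NeZero.ne n)
  let F : ℤ → Set (Strip m) := fun k => {p | p.2 - k * n ∈ Set.Icc (0 : ℝ) n}
  refine LocallyFinite.continuous (f := F) ?_ ?_ ?_ ?_
  · intro p
    refine ⟨{q | |q.2 - p.2| < n}, ?_, ?_⟩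
    · refine IsOpen.mem_nhds ?_ (by simpa using hn)
      exact isOpen_lt (by fun_prop) continuous_const
    · refine (Set.finite_Icc (⌊p.2 / n⌋ - 2) (⌊p.2 / n⌋ + 2)).subset ?_
      rintro k ⟨q, ⟨hq0, hq1⟩, hq⟩
      have hq' := abs_lt.1 (show |q.2 - p.2| < n from hq)
      have h1 := (le_div_iff₀ hn).1 (Int.floor_le (p.2 / n))
      have h2 := (div_lt_iff₀ hn).1 (Int.lt_floor_add_one (p.2 / n))
      have a1 : ((⌊p.2 / n⌋ : ℤ) : ℝ) < k + 2 := by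
        refine lt_of_mul_lt_mul_right ?_ hn.le
        linarith
      have a2 : (k : ℝ) < (⌊p.2 / n⌋ : ℤ) + 2 := by
        refine lt_of_mul_lt_mul_right ?_ hn.le
        linarith
      have a1' : ⌊p.2 / n⌋ < k + 2 := by exact_mod_cast a1
      have a2' : k < ⌊p.2 / n⌋ + 2 := by exact_mod_cast a2
      constructor <;> omega
  · refine Set.eq_univ_of_forall fun p => Set.mem_iUnion.2 ⟨⌊p.2 / n⌋, ?_⟩
    have h1 := (le_div_iff₀ hn).1 (Int.floor_le (p.2 / n))
    have h2 := (div_lt_iff₀ hn).1 (Int.lt_floor_add_one (p.2 / n))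
    constructor <;> linarith
  · intro k
    exact isClosed_Icc.preimage (by fun_prop)
  · intro k
    rw [continuousOn_iff_continuous_domRestrict]
    have e : (F k).domRestrict (cover : Strip m → MobiusStrip m n) = fun p : F k =>
        toMobius (if Even k then p.1.1 else reflect p.1.1, ⟨p.1.2 - k * n, p.2⟩) := by
      funext p
      exact cover_eq p.1 k p.2
    rw [e]
    refine continuous_toMobius.comp (Continuous.prodMk ?_ (by fun_prop))
    by_cases hk : Even k
    · simp only [hk, if_true]
      fun_prop
    · simp only [hk, if_false]
      exact continuous_reflect.comp (by fun_prop)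

/-! ### The map from the graph to the Möbius strip -/

/-- The centre `(a + 1/2, b + 1/2)` of a square of the strip. -/
def stripCentre (p : StripSquare m) : Strip m :=
  (⟨(p.1 : ℝ) + 1 / 2, by
    have h : ((p.1 : ℕ) : ℝ) + 1 ≤ m := by exact_mod_cast p.1.2
    have h' : (0 : ℝ) ≤ ((p.1 : ℕ) : ℝ) := by positivity
    constructor <;> linarith⟩, (p.2 : ℝ) + 1 / 2)

/-- The centre `(a + 1/2, b + 1/2)` of a square of the board, as a point of the Möbius strip. -/
def centre (u : Square m n) : MobiusStrip m n :=
  toMobius (⟨(u.col : ℝ) + 1 / 2, (stripCentre u.lift).1.2⟩, ⟨(u.row : ℝ) + 1 / 2, by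
    have h : ((u.row : ℕ) : ℝ) + 1 ≤ n := by exact_mod_cast u.row.2
    have h' : (0 : ℝ) ≤ ((u.row : ℕ) : ℝ) := by positivity
    constructor <;> linarith⟩)

theorem cover_stripCentre [NeZero n] (p : StripSquare m) :
    (cover (stripCentre p) : MobiusStrip m n) = centre (proj p) := by
  have hn : (0 : ℤ) < n := by exact_mod_cast Nat.pos_of_ne_zero (NeZero.ne n)
  have h1 := Int.emod_nonneg p.2 hn.ne'
  have h2 : (p.2 : ℝ) - ((p.2 / (n : ℤ) : ℤ) : ℝ) * n = ((p.2 % (n : ℤ)).toNat : ℝ) := by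
    have a : p.2 - (p.2 / (n : ℤ)) * n = ((p.2 % (n : ℤ)).toNat : ℤ) := by
      rw [Int.toNat_of_nonneg h1]
      linarith [Int.emod_add_mul_ediv p.2 n, mul_comm (n : ℤ) (p.2 / n)]
    exact_mod_cast congrArg (Int.cast : ℤ → ℝ) a
  have h3 : ((p.2 % (n : ℤ)).toNat : ℝ) + 1 ≤ n := by
    have := Int.emod_lt_of_pos p.2 hn
    have a : (p.2 % (n : ℤ)).toNat + 1 ≤ n := by omega
    exact_mod_cast a
  have h4 : (0 : ℝ) ≤ ((p.2 % (n : ℤ)).toNat : ℝ) := by positivity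
  rw [cover_eq (stripCentre p) (p.2 / (n : ℤ))
    (by simp only [stripCentre]; constructor <;> linarith)]
  unfold centre
  congr 1
  refine Prod.ext (Subtype.ext ?_) (Subtype.ext ?_)
  · by_cases hk : Even (p.2 / (n : ℤ))
    · simp [stripCentre, proj, hk]
    · have h5 : ((p.1.rev : Fin m) : ℝ) = m - (p.1 + 1) := by
        rw [Fin.val_rev, Nat.cast_sub p.1.2]
        push_cast
        ring
      simp only [stripCentre, proj, hk, if_false, reflect, h5]
      ring
  · simp only [stripCentre, proj]
    linarith

/-- The straight line segment between two points of the strip. -/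
def stripSegment (p q : Strip m) : Path p q where
  toFun t := (⟨AffineMap.lineMap (p.1 : ℝ) (q.1 : ℝ) (t : ℝ),
    (convex_Icc (0 : ℝ) m).lineMap_mem p.1.2 q.1.2 t.2⟩, AffineMap.lineMap p.2 q.2 (t : ℝ))
  continuous_toFun := by
    simp only [AffineMap.lineMap_apply]
    fun_prop
  source' := by ext <;> simp
  target' := by ext <;> simp

/-- A knight move, mapped to the Möbius strip: the image under the covering map of the straight line
segment between the centres of the two squares in the strip. -/
def movePath [NeZero n] {u v : Square m n} (e : u ⟶ v) : Path (centre u) (centre v) :=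
  ((stripSegment (stripCentre u.lift) (stripCentre (Move.dest e))).map continuous_cover).cast
    (by rw [cover_stripCentre, proj_lift])
    (by rw [cover_stripCentre, Move.proj_dest e])

/-- A path in the knight graph, mapped to the Möbius strip by concatenating its moves. -/
def pathInMobius [NeZero n] {u : Square m n} :
    ∀ {v : Square m n}, Quiver.Path u v → Path (centre u) (centre v)
  | _, .nil => Path.refl _
  | _, .cons p e => (pathInMobius p).trans (movePath e)

/-- The element of the fundamental group of the Möbius strip given by a closed path in the
knight graph. -/
def loopClass [NeZero n] {u : Square m n} (p : Quiver.Path u u) :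
    FundamentalGroup (MobiusStrip m n) (centre u) :=
  FundamentalGroup.fromPath (Path.Homotopic.Quotient.mk (pathInMobius p))

/-- A nullhomotopic tour, based at the square `(0, 0)`: a knight's tour that gives the identity of
the fundamental group of the Möbius strip. -/
def IsNullhomotopicTour [NeZero m] [NeZero n]
    (p : Quiver.Path (baseSquare m n) (baseSquare m n)) : Prop :=
  IsKnightsTour p ∧ loopClass p = 1

end

end MobiusKnight

/-! Lift a closed path of the knight graph to the strip, starting in sheet 0. It ends over its
starting square, in the sheet numbered `level p`, and by `loopClass_eq_one_iff` the loop is trivial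
exactly when that number is 0. A nullhomotopic tour is therefore a closed knight's walk in the plane
strip that meets each orbit of the glide reflection once (`IsLiftedTour`). Edge distinctness is then
automatic once the board has at least three squares.

Obstructions. A closed walk in the strip alternates chessboard colours, so `m * n` is even. Width
one has no moves. In width two a walk that does not backtrack moves vertically in one direction
forever. In width four the two outer columns contain half of the squares and no two of these are
adjacent, so outer and inner squares alternate; for odd `n` the gluing respects the chessboard
colouring, so only outer squares of one colour would be visited. The `3 × 4` board is excluded by
exhaustive search.

Existence. Tours are enlarged in two directions. `IsPieceTour.widen` adds two columns at each
border: the border squares of the old tour are grouped in consecutive pairs, and each pair makes a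
detour through a parallel translate of itself in the new columns; the detours are the new border
pairs, so this can be repeated. `IsSeed.isPieceTour` adds rows: two walks `P` and `Q` are attached
at the ends of a tour, so that the new ends are vertical translates of the old ones, and this too
repeats. That the result meets every orbit for every number of repetitions reduces to a finite check
(`exists_glide_mem`). Explicit seeds of widths 3 to 8, together with two single tours, then give all
remaining boards. -/

namespace MobiusKnight

variable {m n : ℕ}

/-! ### Deck transformations of the strip -/

/-- The `k`-th power of the glide reflection `(x, y) ↦ (m - x, y + n)` of the strip. -/
def deck (n : ℕ) (k : ℤ) (p : Strip m) : Strip m :=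
  (if Even k then p.1 else reflect p.1, p.2 + k * n)

theorem reflect_reflect (x : Set.Icc (0 : ℝ) m) : reflect (reflect x) = x :=
  Subtype.ext (by simp [reflect])

theorem cover_deck [NeZero n] (k : ℤ) (p : Strip m) :
    (cover (deck n k p) : MobiusStrip m n) = cover p := by
  have hn : (n : ℝ) ≠ 0 := by exact_mod_cast NeZero.ne n
  have h : ⌊(p.2 + k * n) / (n : ℝ)⌋ = ⌊p.2 / n⌋ + k := by
    rw [add_div, mul_div_cancel_right₀ _ hn, Int.floor_add_intCast]
  unfold cover
  congr 1
  refine Prod.ext ?_ (Subtype.ext ?_)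
  · by_cases hk : Even k <;> by_cases hp : Even ⌊p.2 / (n : ℝ)⌋ <;>
      simp [deck, h, hk, hp, Int.even_add, reflect_reflect]
  · simp only [deck, h]
    push_cast
    ring

theorem stripCentre_shift (k : ℤ) (p : StripSquare m) :
    stripCentre (shift n k p) = deck n k (stripCentre p) := by
  refine Prod.ext (Subtype.ext ?_) ?_
  · by_cases hk : Even k
    · simp [stripCentre, shift, deck, hk]
    · have h5 : ((p.1.rev : Fin m) : ℝ) = m - (p.1 + 1) := by
        rw [Fin.val_rev, Nat.cast_sub p.1.2]
        push_cast
        ring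
      simp only [stripCentre, shift, deck, hk, if_false, reflect, h5]
      ring
  · simp only [stripCentre, shift, deck]
    push_cast
    ring

/-- Deck transformations are affine. This lets a move be lifted starting from any sheet. -/
theorem stripSegment_deck (k : ℤ) (p q : Strip m) (t : unitInterval) :
    stripSegment (deck n k p) (deck n k q) t = deck n k (stripSegment p q t) := by
  refine Prod.ext (Subtype.ext ?_) ?_
  · change AffineMap.lineMap ((deck n k p).1 : ℝ) ((deck n k q).1 : ℝ) (t : ℝ) =
      ((if Even k then (stripSegment p q t).1 else reflect (stripSegment p q t).1 :
        Set.Icc (0 : ℝ) m) : ℝ)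
    by_cases hk : Even k
    · simp only [deck, hk, if_true]
      rfl
    · simp only [deck, hk, if_false, reflect]
      change _ = (m : ℝ) - AffineMap.lineMap (p.1 : ℝ) (q.1 : ℝ) (t : ℝ)
      simp only [AffineMap.lineMap_apply, vsub_eq_sub, vadd_eq_add, smul_eq_mul]
      ring
  · change AffineMap.lineMap (p.2 + k * n) (q.2 + k * n) (t : ℝ) =
      AffineMap.lineMap p.2 q.2 (t : ℝ) + k * n
    simp only [AffineMap.lineMap_apply, vsub_eq_sub, vadd_eq_add, smul_eq_mul]
    ring

/-! ### The winding number of a path in the knight graph -/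

/-- The lift of `p` that starts at `u.lift` ends at `shift n (level p) v.lift`. -/
def level [NeZero n] {u : Square m n} : ∀ {v : Square m n}, Quiver.Path u v → ℤ
  | _, .nil => 0
  | _, .cons p e => level p + (Move.dest e).2 / (n : ℤ)

theorem dest_eq_shift [NeZero n] {u v : Square m n} (e : u ⟶ v) :
    Move.dest e = shift n ((Move.dest e).2 / (n : ℤ)) v.lift := by
  have h : v.lift = shift n (-((Move.dest e).2 / (n : ℤ))) (Move.dest e) := by
    rw [← lift_proj, Move.proj_dest]
  rw [h, shift_shift, add_neg_cancel, shift_zero]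

/-- The lift is built by hand, moving each segment by the deck transformation of the sheet reached
so far. Thus `cover` need not be known to be a covering map. -/
theorem exists_lift_pathInMobius [NeZero n] {u v : Square m n} (p : Quiver.Path u v) :
    ∃ Γ : Path (stripCentre u.lift) (stripCentre (shift n (level p) v.lift)),
      ∀ t, pathInMobius p t = cover (Γ t) := by
  induction p with
  | nil =>
    refine ⟨(Path.refl _).cast rfl (by simp [level, shift_zero]), fun t => ?_⟩
    have h : (cover (stripCentre u.lift) : MobiusStrip m n) = centre u := by
      rw [cover_stripCentre, proj_lift]
    simp [pathInMobius, h]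
  | @cons w v p e ih =>
    obtain ⟨Γ, hΓ⟩ := ih
    have h1 : deck n (level p) (stripCentre w.lift) = stripCentre (shift n (level p) w.lift) :=
      (stripCentre_shift _ _).symm
    have h2 : stripCentre (shift n (level (p.cons e)) v.lift) =
        deck n (level p) (stripCentre (Move.dest e)) := by
      rw [← stripCentre_shift]
      conv_rhs => rw [dest_eq_shift e]
      rw [shift_shift]
      rfl
    refine ⟨Γ.trans ((stripSegment (deck n (level p) (stripCentre w.lift))
      (deck n (level p) (stripCentre (Move.dest e)))).cast h1.symm h2), fun t => ?_⟩
    change (pathInMobius p).trans (movePath e) t = _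
    rw [Path.trans_apply, Path.trans_apply]
    split_ifs with ht
    · exact hΓ _
    · rw [Path.cast_coe, stripSegment_deck, cover_deck]
      rfl

/-- The height of a point of the Möbius strip, modulo `n`. -/
def height (m n : ℕ) : MobiusStrip m n → AddCircle (n : ℝ) :=
  Quot.lift (fun p => ((p.2 : ℝ) : AddCircle (n : ℝ))) (by
    rintro p q ⟨h1, h2, -⟩
    rw [h1, h2, QuotientAddGroup.mk_zero, AddCircle.coe_period])

theorem continuous_height : Continuous (height m n) :=
  continuous_quot_lift _ ((AddCircle.continuous_mk' _).comp (by fun_prop))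

theorem height_cover (p : Strip m) [NeZero n] :
    height m n (cover p) = (p.2 : AddCircle (n : ℝ)) := by
  change ((p.2 - ⌊p.2 / n⌋ * n : ℝ) : AddCircle (n : ℝ)) = _
  rw [← zsmul_eq_mul, AddCircle.coe_sub, AddCircle.coe_zsmul, AddCircle.coe_period, zsmul_zero,
    sub_zero]

instance simplyConnectedSpace_strip : SimplyConnectedSpace (Strip m) := by
  have : ContractibleSpace (Set.Icc (0 : ℝ) m) :=
    (convex_Icc (0 : ℝ) m).contractibleSpace ⟨0, by simp⟩
  infer_instance

/-- If the level is 0, the lift is a loop in the simply connected strip, and its contraction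
projects to the Möbius strip. Conversely, `height` sends the loop to a circle of length `n`, where
the vertical coordinate of the lift is a lift to `ℝ`; a contractible loop has a closed lift, so
`level p * n = 0`. -/
theorem loopClass_eq_one_iff [NeZero n] {u : Square m n} (p : Quiver.Path u u) :
    loopClass p = 1 ↔ level p = 0 := by
  obtain ⟨Γ, hΓ⟩ := exists_lift_pathInMobius p
  have hu : centre u = (cover (stripCentre u.lift) : MobiusStrip m n) := by
    rw [cover_stripCentre, proj_lift]
  have h0 : loopClass p = 1 ↔ Path.Homotopic (pathInMobius p) (Path.refl _) := by
    rw [← Path.Homotopic.Quotient.eq]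
    rfl
  rw [h0]
  constructor
  · intro h
    have hn : (n : ℝ) ≠ 0 := by exact_mod_cast NeZero.ne n
    have cov := AddCircle.isCoveringMap_coe (n : ℝ)
    have hmap := h.map ⟨height m n, continuous_height⟩
    let Γ' : C(unitInterval, ℝ) := ⟨fun t => (Γ t).2, by fun_prop⟩
    have hc : height m n (centre u) = ((stripCentre u.lift).2 : AddCircle (n : ℝ)) := by
      rw [hu, height_cover]
    -- Compares the endpoints of two lifts through `ℝ → AddCircle n`; the rewrites below identify
    -- these lifts with `Γ'` and with a constant.
    have key := cov.liftPath_apply_one_eq_of_homotopicRel hmap (stripCentre u.lift).2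
      (by simpa using hc) (by simpa using hc)
    rw [← (cov.eq_liftPath_iff' _ (Γ := Γ')).2 ⟨?_, ?_⟩,
      ← (cov.eq_liftPath_iff' _ (Γ := ContinuousMap.const _ (stripCentre u.lift).2)).2
        ⟨?_, ?_⟩] at key
    · have h1 : (stripCentre (shift n (level p) u.lift)).2 = (stripCentre u.lift).2 := by
        simpa [Γ'] using key
      have h2 : (level p : ℝ) * n = 0 := by
        rw [stripCentre_shift] at h1
        simpa [deck] using h1
      exact_mod_cast (mul_eq_zero.1 h2).resolve_right hn
    · funext t
      exact hc.symm
    · rfl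
    · funext t
      exact (height_cover (n := n) (Γ t)).symm.trans (congrArg (height m n) (hΓ t).symm)
    · simp [Γ']
  · intro h
    have he : stripCentre u.lift = stripCentre (shift n (level p) u.lift) := by
      rw [h, shift_zero]
    have h1 := ((SimplyConnectedSpace.paths_homotopic (Γ.cast rfl he) (Path.refl _)).map
      ⟨cover (n := n), continuous_cover⟩).pathCast hu hu
    convert h1 using 1
    · ext t
      exact hΓ t
    · ext t
      exact hu

end MobiusKnight

namespace MobiusKnight

variable {m n : ℕ}

/-! ### Tours as closed sequences of squares of the strip -/

/-- The squares of the strip visited by the lift of a path. -/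
def lifted [NeZero n] {u : Square m n} : ∀ {v : Square m n}, Quiver.Path u v → ℕ → StripSquare m
  | _, .nil, _ => u.lift
  | _, .cons p e, i => if i ≤ p.length then lifted p i else shift n (level p) (Move.dest e)

theorem lifted_zero [NeZero n] {u v : Square m n} (p : Quiver.Path u v) : lifted p 0 = u.lift := by
  induction p with
  | nil => rfl
  | cons p e ih => simp [lifted, ih]

theorem lifted_length [NeZero n] {u v : Square m n} (p : Quiver.Path u v) :
    lifted p p.length = shift n (level p) v.lift := by
  cases p with
  | nil => simp [lifted, level, shift_zero]
  | cons p e =>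
    simp only [lifted, level, Quiver.Path.length_cons, Nat.not_succ_le_self, if_false]
    conv_lhs => rw [dest_eq_shift e]
    rw [shift_shift]

theorem lifted_cons_of_le [NeZero n] {u v w : Square m n} (p : Quiver.Path u v) (e : v ⟶ w)
    {i : ℕ} (h : i ≤ p.length) : lifted (p.cons e) i = lifted p i := by
  simp [lifted, h]

theorem lifted_cons_succ [NeZero n] {u v w : Square m n} (p : Quiver.Path u v) (e : v ⟶ w) :
    lifted (p.cons e) (p.length + 1) = shift n (level p) (Move.dest e) := by
  simp [lifted]

theorem adj_lifted [NeZero n] {u v : Square m n} (p : Quiver.Path u v) {i : ℕ}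
    (h : i < p.length) : (stripGraph m).Adj (lifted p i) (lifted p (i + 1)) := by
  induction p with
  | nil => simp at h
  | cons p e ih =>
    rw [Quiver.Path.length_cons] at h
    rcases (Nat.lt_succ_iff.1 h).lt_or_eq with h | rfl
    · rw [lifted_cons_of_le p e h.le, lifted_cons_of_le p e h]
      exact ih h
    · rw [lifted_cons_of_le p e le_rfl, lifted_cons_succ, lifted_length]
      exact adj_shift (Move.adj e)

theorem vertices_eq_map_lifted [NeZero n] {u v : Square m n} (p : Quiver.Path u v) :
    p.vertices = (List.range (p.length + 1)).map fun i => proj (lifted p i) := by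
  induction p with
  | nil => simp [lifted, proj_lift]
  | cons p e ih =>
    rw [Quiver.Path.vertices_cons, Quiver.Path.length_cons, List.range_succ, List.map_append, ih,
      List.concat_eq_append]
    congr 1
    · refine List.map_congr_left fun i hi => ?_
      rw [lifted_cons_of_le p e (Nat.lt_succ_iff.1 (List.mem_range.1 hi))]
    · simp [lifted_cons_succ, proj_shift, Move.proj_dest]

/-- A step back in the strip is the reverse of the preceding directed edge, hence the same edge. In
a tour of more than two squares the distinctness of the vertices would suffice; on the `2 × 1` board
only this excludes going out and back along one edge. -/
theorem lifted_add_two_ne [NeZero n] {u v : Square m n} (p : Quiver.Path u v)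
    (h : (darts p).Pairwise fun e f => ¬ SameEdge e f) {i : ℕ} (hi : i + 2 ≤ p.length) :
    lifted p (i + 2) ≠ lifted p i := by
  induction p with
  | nil => simp at hi
  | @cons w v p e ih =>
    rw [Quiver.Path.length_cons] at hi
    rw [darts, List.pairwise_append] at h
    rcases (Nat.lt_succ_iff.1 (Nat.lt_of_succ_le hi)).lt_or_eq with hlt | heq
    · rw [lifted_cons_of_le p e hlt, lifted_cons_of_le p e (by omega)]
      exact ih h.1 hlt
    · cases p with
      | nil => simp at heq
      | @cons x w q d =>
        simp only [Quiver.Path.length_cons, Nat.add_right_cancel_iff] at heq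
        subst heq
        intro hback
        rw [lifted_cons_of_le _ e (i := q.length) (by simp), lifted_cons_of_le q d le_rfl,
          lifted_length] at hback
        have h1 : lifted ((q.cons d).cons e) (q.length + 2) =
          shift n (level q + (Move.dest d).2 / n) (Move.dest e) := lifted_cons_succ (q.cons d) e
        rw [h1] at hback
        have hd : Move.dest e = shift n (-((Move.dest d).2 / n)) x.lift := by
          have h2 := congrArg (shift n (-(level q + (Move.dest d).2 / n))) hback
          rw [shift_shift, shift_shift, neg_add_cancel, shift_zero] at h2
          rw [h2]
          congr 1
          ring
        have hx : v = x := by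
          rw [← Move.proj_dest e, hd, proj_shift, proj_lift]
        subst hx
        refine h.2.2 ⟨_, _, d⟩ (by simp [darts]) ⟨_, _, e⟩ (by simp) (Or.inr ?_)
        have : e = Quiver.reverse d := Move.ext hd
        rw [this]

/-- The squares of the board, as pairs. -/
def squareEquiv (m n : ℕ) : Square m n ≃ Fin m × Fin n where
  toFun u := (u.col, u.row)
  invFun p := ⟨p.1, p.2⟩
  left_inv _ := rfl
  right_inv _ := rfl

instance : Fintype (Square m n) := Fintype.ofEquiv _ (squareEquiv m n).symm

instance : DecidableEq (Square m n) := (squareEquiv m n).decidableEq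

theorem card_square : Fintype.card (Square m n) = m * n := by
  rw [Fintype.card_congr (squareEquiv m n)]
  simp

/-- A closed knight's walk in the strip that starts at `(0, 0)` and meets every orbit of the deck
transformations, in as many steps as there are orbits. -/
structure IsLiftedTour [NeZero m] [NeZero n] (f : ℕ → StripSquare m) : Prop where
  zero : f 0 = (baseSquare m n).lift
  closed : f (m * n) = f 0
  adj : ∀ i < m * n, (stripGraph m).Adj (f i) (f (i + 1))
  surj : ∀ v : Square m n, ∃ i < m * n, proj (f i) = v

theorem exists_isLiftedTour [NeZero m] [NeZero n] (hmn : 1 < m * n)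
    (h : ∃ p : Quiver.Path (baseSquare m n) (baseSquare m n), IsNullhomotopicTour p) :
    ∃ f : ℕ → StripSquare m, IsLiftedTour (n := n) f ∧
      ∀ i, i + 2 ≤ m * n → f (i + 2) ≠ f i := by
  obtain ⟨p, ⟨hmem, hnodup, hedge⟩, hloop⟩ := h
  rw [loopClass_eq_one_iff] at hloop
  have hend : lifted p p.length = lifted p 0 := by
    rw [lifted_length, hloop, shift_zero, lifted_zero]
  -- The trivial path on a single square is the one tour whose length is not `m * n`; `hmn` rules it
  -- out.
  have hpos : 0 < p.length := by
    by_contra! h0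
    have hv := vertices_eq_map_lifted p
    rw [Nat.le_zero.1 h0] at hv
    have hc : Fintype.card (Square m n) ≤ 1 := Fintype.card_le_one_iff.2 fun a b => by
      have ha := hmem a
      have hb := hmem b
      rw [hv] at ha hb
      simp at ha hb
      rw [ha, hb]
    rw [card_square] at hc
    omega
  have hsurj : ∀ v : Square m n, ∃ i < p.length, proj (lifted p i) = v := by
    intro v
    have hv := hmem v
    rw [vertices_eq_map_lifted, List.mem_map] at hv
    obtain ⟨i, hi, rfl⟩ := hv
    rcases (Nat.lt_succ_iff.1 (List.mem_range.1 hi)).lt_or_eq with h | rfl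
    · exact ⟨i, h, rfl⟩
    · exact ⟨0, hpos, by rw [hend]⟩
  have htail : p.vertices.tail = (List.range p.length).map fun i => proj (lifted p (i + 1)) := by
    rw [vertices_eq_map_lifted, List.range_succ_eq_map]
    simp [Function.comp_def]
  have hlen : p.length = m * n := by
    have hu : p.vertices.tail.toFinset = Finset.univ := by
      refine Finset.eq_univ_of_forall fun v => ?_
      obtain ⟨i, hi, rfl⟩ := hsurj v
      rw [List.mem_toFinset, htail, List.mem_map]
      rcases Nat.eq_zero_or_pos i with rfl | h0
      · exact ⟨p.length - 1, List.mem_range.2 (by omega), by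
          rw [Nat.sub_add_cancel hpos, hend]⟩
      · exact ⟨i - 1, List.mem_range.2 (by omega), by rw [Nat.sub_add_cancel h0]⟩
    have h1 := List.toFinset_card_of_nodup hnodup
    rw [hu, Finset.card_univ, card_square, htail] at h1
    simpa using h1.symm
  rw [hlen] at hend hsurj
  exact ⟨lifted p, ⟨lifted_zero p, hend, fun i hi => adj_lifted p (hlen ▸ hi), hsurj⟩,
    fun i hi => lifted_add_two_ne p hedge (hlen ▸ hi)⟩

/-- The move on the board under a move in the strip. -/
def moveOfAdj [NeZero n] {p q : StripSquare m} (h : (stripGraph m).Adj p q) :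
    (proj p : Square m n) ⟶ proj q :=
  Move.mk (shift n (-(p.2 / (n : ℤ))) q) (by rw [lift_proj]; exact adj_shift h) (proj_shift _ _)

/-- As `f 0` lies in sheet 0, the level is the sheet number of `f k`, so a closed sequence yields
level 0. -/
theorem exists_path_of_adj [NeZero n] (f : ℕ → StripSquare m) (h0 : f 0 = (proj (f 0) : Square m n).lift)
    (k : ℕ) (hf : ∀ i < k, (stripGraph m).Adj (f i) (f (i + 1))) :
    ∃ p : Quiver.Path (proj (f 0) : Square m n) (proj (f k)),
      p.vertices = (List.range (k + 1)).map (fun i => proj (f i)) ∧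
      (darts p).map (fun e => (e.left, e.right)) =
        (List.range k).map (fun i => (proj (f i), proj (f (i + 1)))) ∧
      level p = (f k).2 / n := by
  have hn : (n : ℤ) ≠ 0 := by exact_mod_cast NeZero.ne n
  induction k with
  | zero =>
    refine ⟨.nil, by simp, by simp [darts], ?_⟩
    rw [h0]
    simp only [level, Square.lift]
    rw [Int.ediv_eq_zero_of_lt (by positivity) (by exact_mod_cast (Fin.is_lt _))]
  | succ k ih =>
    obtain ⟨p, h1, h2, h3⟩ := ih fun i hi => hf i (by omega)
    refine ⟨p.cons (moveOfAdj (hf k (Nat.lt_succ_self k))), ?_, ?_, ?_⟩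
    · rw [Quiver.Path.vertices_cons, h1, List.range_succ (n := k + 1), List.map_append,
        List.concat_eq_append]
      rfl
    · rw [darts, List.map_append, h2, List.range_succ (n := k), List.map_append]
      rfl
    · change level p + ((f (k + 1)).2 + -((f k).2 / n) * n) / n = _
      rw [h3, Int.add_mul_ediv_right _ _ hn]
      ring

/-- A surjection from `m * n` indices onto `m * n` squares is injective. An edge used twice in the
same direction would repeat a vertex; used in opposite directions it would force two consecutive
steps out and back, impossible with three or more squares. -/
theorem IsLiftedTour.exists_isNullhomotopicTour [NeZero m] [NeZero n] {f : ℕ → StripSquare m}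
    (h : IsLiftedTour (n := n) f) (hmn : 3 ≤ m * n) :
    ∃ p : Quiver.Path (baseSquare m n) (baseSquare m n), IsNullhomotopicTour p := by
  have hb : (proj (f 0) : Square m n) = baseSquare m n := by rw [h.zero, proj_lift]
  have hN : (proj (f (m * n)) : Square m n) = baseSquare m n := by rw [h.closed, hb]
  have hp := exists_path_of_adj (n := n) f (by rw [hb, h.zero]) (m * n) h.adj
  rw [hb, hN] at hp
  obtain ⟨p, h1, h2, h3⟩ := hp
  have h4 : (f (m * n)).2 / n = 0 := by
    rw [h.closed, h.zero]
    simp only [Square.lift]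
    rw [Int.ediv_eq_zero_of_lt (by positivity) (by exact_mod_cast (Fin.is_lt _))]
  have hinj : ∀ i < m * n, ∀ j < m * n, (proj (f i) : Square m n) = proj (f j) → i = j := by
    have hbij : Function.Bijective fun i : Fin (m * n) => (proj (f i) : Square m n) := by
      rw [Fintype.bijective_iff_surjective_and_card]
      refine ⟨fun v => ?_, by rw [card_square, Fintype.card_fin]⟩
      obtain ⟨i, hi, rfl⟩ := h.surj v
      exact ⟨⟨i, hi⟩, rfl⟩
    intro i hi j hj hij
    exact congrArg Fin.val (@hbij.1 ⟨i, hi⟩ ⟨j, hj⟩ hij)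
  have hcl : (proj (f (m * n)) : Square m n) = proj (f 0) := by rw [h.closed]
  refine ⟨p, ⟨fun v => ?_, ?_, ?_⟩, (loopClass_eq_one_iff p).2 (h3.trans h4)⟩
  · obtain ⟨i, hi, rfl⟩ := h.surj v
    rw [h1, List.mem_map]
    exact ⟨i, List.mem_range.2 (by omega), rfl⟩
  · have h5 : p.vertices.tail = (List.range (m * n)).map fun i => proj (f (i + 1)) := by
      rw [h1, List.range_succ_eq_map]
      simp [Function.comp_def]
    rw [h5]
    refine List.nodup_range.map_on fun i hi j hj hij => ?_
    rw [List.mem_range] at hi hj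
    rcases (show i + 1 ≤ m * n from hi).lt_or_eq with hi' | hi' <;>
      rcases (show j + 1 ≤ m * n from hj).lt_or_eq with hj' | hj'
    · have := hinj _ hi' _ hj' hij
      omega
    · rw [hj', hcl] at hij
      have := hinj _ hi' 0 (by omega) hij
      omega
    · rw [hi', hcl] at hij
      have := hinj 0 (by omega) _ hj' hij
      omega
    · omega
  · have h6 : ((darts p).map fun e => (e.left, e.right)).Pairwise fun a b =>
        b ≠ a ∧ b ≠ (a.2, a.1) := by
      rw [h2, List.pairwise_map]
      refine List.pairwise_lt_range.imp_of_mem fun {i j} hi hj hij => ?_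
      rw [List.mem_range] at hi hj
      refine ⟨fun heq => ?_, fun heq => ?_⟩
      · have := hinj _ hj _ hi (Prod.mk.inj heq).1
        omega
      · obtain ⟨e1, e2⟩ := Prod.mk.inj heq
        have h7 := hinj _ hj _ (by omega) e1
        subst h7
        rcases (show i + 1 + 1 ≤ m * n from hj).lt_or_eq with hj' | hj'
        · have := hinj _ hj' _ hi e2
          omega
        · rw [hj', hcl] at e2
          have := hinj _ (by omega) _ hi e2
          omega
    rw [List.pairwise_map] at h6
    refine h6.imp ?_
    rintro a b ⟨hne, hne'⟩ (rfl | rfl)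
    · exact hne rfl
    · exact hne' rfl

end MobiusKnight

namespace MobiusKnight

variable {m n : ℕ}

/-! ### Obstructions -/

/-- The colour of a square of the strip, as on a chessboard. -/
def colour (p : StripSquare m) : ℤ := p.1 + p.2

theorem odd_colour_sub {p q : StripSquare m} (h : (stripGraph m).Adj p q) :
    Odd (colour q - colour p) := by
  have e : colour q - colour p = ((q.1 : ℤ) - p.1) + (q.2 - p.2) := by
    unfold colour
    ring
  rw [e, Int.odd_iff]
  rcases h with ⟨h1, h2⟩ | ⟨h1, h2⟩ <;>
    rcases (abs_eq (by norm_num)).1 h1 with h1 | h1 <;>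
    rcases (abs_eq (by norm_num)).1 h2 with h2 | h2 <;> rw [h1, h2] <;> rfl

theorem even_colour_sub (f : ℕ → StripSquare m) (k : ℕ)
    (hf : ∀ i < k, (stripGraph m).Adj (f i) (f (i + 1))) :
    Even (colour (f k) - colour (f 0) - k) := by
  induction k with
  | zero => simp
  | succ k ih =>
    have h1 := ih fun i hi => hf i (by omega)
    have h2 := odd_colour_sub (hf k (Nat.lt_succ_self k))
    rw [Int.even_iff] at h1 ⊢
    rw [Int.odd_iff] at h2
    push_cast
    omega

theorem IsLiftedTour.even_mul [NeZero m] [NeZero n] {f : ℕ → StripSquare m}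
    (h : IsLiftedTour (n := n) f) : Even (m * n) := by
  have h1 := even_colour_sub f (m * n) h.adj
  rw [h.closed, sub_self, zero_sub, even_neg] at h1
  exact_mod_cast h1

theorem IsLiftedTour.one_lt_width [NeZero m] [NeZero n] {f : ℕ → StripSquare m}
    (h : IsLiftedTour (n := n) f) (hmn : 0 < m * n) : 1 < m := by
  by_contra! hm
  have h1 := (f 0).1.2
  have h2 := (f (0 + 1)).1.2
  have h3 : ((f (0 + 1)).1 : ℤ) - (f 0).1 = 0 := by omega
  rcases h.adj 0 hmn with h | h <;> rw [h3] at h <;> simp at h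

/-- Each move changes the column and moves two rows up or down. Reversing the vertical direction
would be backtracking, so all moves have the vertical direction of the first. -/
theorem not_closed_of_width_two [NeZero n] (f : ℕ → StripSquare 2) (N : ℕ) (hN : 0 < N)
    (hadj : ∀ i < N, (stripGraph 2).Adj (f i) (f (i + 1)))
    (hback : ∀ i, i + 2 ≤ N → f (i + 2) ≠ f i) : f N ≠ f 0 := by
  have key : ∀ i < N, ((f (i + 1)).1 : ℕ) = 1 - (f i).1 ∧
      |(f (i + 1)).2 - (f i).2| = 2 := by
    intro i hi
    have h1 := (f i).1.2
    have h2 := (f (i + 1)).1.2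
    rcases hadj i hi with ⟨h3, h4⟩ | ⟨h3, -⟩ <;>
      rcases (abs_eq (by norm_num)).1 h3 with h3 | h3
    · exact ⟨by omega, h4⟩
    · exact ⟨by omega, h4⟩
    · omega
    · omega
  have mono : ∀ k < N, (f (k + 1)).2 - (f 0).2 = (k + 1) * ((f 1).2 - (f 0).2) ∧
      (f (k + 1)).2 - (f k).2 = (f 1).2 - (f 0).2 := by
    intro k hk
    induction k with
    | zero => simp
    | succ k ih =>
      obtain ⟨h1, h2⟩ := ih (by omega)
      have h3 : (f (k + 1 + 1)).2 - (f (k + 1)).2 = (f (k + 1)).2 - (f k).2 := by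
        have h4 := key k (by omega)
        have h5 := key (k + 1) hk
        have h6 := (f k).1.2
        have h7 : (f (k + 1 + 1)).2 ≠ (f k).2 := fun h8 =>
          hback k hk
            (Prod.ext (Fin.ext (show ((f (k + 1 + 1)).1 : ℕ) = (f k).1 by omega)) h8)
        rcases (abs_eq (by norm_num)).1 h4.2 with h8 | h8 <;>
          rcases (abs_eq (by norm_num)).1 h5.2 with h9 | h9 <;> omega
      refine ⟨?_, by rw [h3, h2]⟩
      push_cast
      linarith
  obtain ⟨k, rfl⟩ := Nat.exists_eq_succ_of_ne_zero hN.ne'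
  intro h
  have h1 := (mono k (Nat.lt_succ_self k)).1
  have h2 := (key 0 hN).2
  rw [Nat.succ_eq_add_one] at h
  rw [h, sub_self] at h1
  rcases mul_eq_zero.1 h1.symm with h3 | h3
  · omega
  · rw [zero_add, h3] at h2
    simp at h2

/-! ### Width four with `n` odd -/

/-- Whether a square lies in the first or the last column of a strip of width four. -/
def outer (a : Fin 4) : ℕ := if a = 0 ∨ a = 3 then 1 else 0

theorem outer_rev (a : Fin 4) : outer a.rev = outer a := by
  revert a; decide

theorem outer_proj [NeZero n] (p : StripSquare 4) : outer (proj p : Square 4 n).col = outer p.1 := by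
  unfold proj
  dsimp only
  split_ifs
  · rfl
  · exact outer_rev _

theorem outer_add_le_one {p q : StripSquare 4} (h : (stripGraph 4).Adj p q) :
    outer p.1 + outer q.1 ≤ 1 := by
  have h1 : |((q.1 : ℕ) : ℤ) - ((p.1 : ℕ) : ℤ)| = 1 ∨ |((q.1 : ℕ) : ℤ) - ((p.1 : ℕ) : ℤ)| = 2 := by
    rcases h with h | h
    · exact Or.inl h.1
    · exact Or.inr h.1
  clear h
  generalize p.1 = a at *
  generalize q.1 = b at *
  revert a b
  decide

theorem IsLiftedTour.sum_eq [NeZero m] [NeZero n] {f : ℕ → StripSquare m}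
    (h : IsLiftedTour (n := n) f) (g : Square m n → ℕ) :
    ∑ i ∈ Finset.range (m * n), g (proj (f i)) = ∑ v, g v := by
  have hbij : Function.Bijective fun i : Fin (m * n) => (proj (f i) : Square m n) := by
    rw [Fintype.bijective_iff_surjective_and_card]
    refine ⟨fun v => ?_, by rw [card_square, Fintype.card_fin]⟩
    obtain ⟨i, hi, rfl⟩ := h.surj v
    exact ⟨⟨i, hi⟩, rfl⟩
  rw [Finset.sum_range, ← hbij.sum_comp]

theorem sum_outer : ∑ v : Square 4 n, outer v.col = 2 * n := by
  rw [← (squareEquiv 4 n).symm.sum_comp, Fintype.sum_prod_type]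
  simp only [squareEquiv, Equiv.coe_fn_symm_mk, Finset.sum_const, Finset.card_univ,
    Fintype.card_fin, smul_eq_mul, ← Finset.mul_sum]
  rw [show ∑ a, outer a = 2 by decide, mul_comm]

/-- Summed over the closed tour, the left side totals `4 * n`, twice the number of outer squares.
Each of the `4 * n` terms is at most 1, so all are equal to 1. -/
theorem IsLiftedTour.outer_add [NeZero n] {f : ℕ → StripSquare 4}
    (h : IsLiftedTour (n := n) f) {i : ℕ} (hi : i < 4 * n) :
    outer (f i).1 + outer (f (i + 1)).1 = 1 := by
  have h1 : ∑ i ∈ Finset.range (4 * n), outer (f i).1 = 2 * n := by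
    rw [← sum_outer, ← h.sum_eq]
    exact Finset.sum_congr rfl fun i _ => (outer_proj _).symm
  have h2 : ∑ i ∈ Finset.range (4 * n), outer (f (i + 1)).1 = 2 * n := by
    have h3 := Finset.sum_range_succ (fun i => outer (f i).1) (4 * n)
    rw [Finset.sum_range_succ', h1, h.closed] at h3
    omega
  have h4 : ∑ i ∈ Finset.range (4 * n), (outer (f i).1 + outer (f (i + 1)).1) =
      ∑ i ∈ Finset.range (4 * n), 1 := by
    rw [Finset.sum_add_distrib, h1, h2]
    simp
    ring
  exact (Finset.sum_eq_sum_iff_of_le fun i hi => outer_add_le_one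
    (h.adj i (Finset.mem_range.1 hi))).1 h4 i (Finset.mem_range.2 hi)

/-- The reflection `a ↦ 3 - a` and the translation by an odd `n` both change the colour, so the
glide reflection preserves it. -/
theorem even_colour_shift (hn : Odd n) (k : ℤ) (p : StripSquare 4) :
    Even (colour (shift n k p) - colour p) := by
  have h1 := p.1.2
  have h2 : Even (k * n) ↔ Even k := by
    rw [Int.even_mul]
    simp [Nat.not_even_iff_odd.2 hn]
  unfold colour shift
  by_cases hk : Even k
  · rw [if_pos hk]
    have := h2.2 hk
    rw [Int.even_iff] at this ⊢
    dsimp only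
    omega
  · rw [if_neg hk]
    have := (not_congr h2).2 hk
    rw [Int.even_iff] at this ⊢
    dsimp only
    rw [Fin.val_rev]
    omega

theorem IsLiftedTour.even_of_width_four [NeZero n] {f : ℕ → StripSquare 4}
    (h : IsLiftedTour (n := n) f) : Even n := by
  by_contra! hn
  rw [Nat.not_even_iff_odd] at hn
  have halt : ∀ i ≤ 4 * n, outer (f i).1 = (i + 1) % 2 := by
    intro i hi
    induction i with
    | zero => rw [h.zero]; rfl
    | succ i ih =>
      have h1 := h.outer_add (i := i) (by omega)
      have h2 := ih (by omega)
      omega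
  -- The square `(3, 0)` is outer, like the start `(0, 0)`, so it is met at an even time; but its
  -- colour is the other one.
  obtain ⟨i, hi, hv⟩ := h.surj ⟨3, ⟨0, Nat.pos_of_ne_zero (NeZero.ne n)⟩⟩
  have h1 := even_colour_sub f i fun j hj => h.adj j (by omega)
  have h2 := halt i hi.le
  rw [← outer_proj (n := n), hv] at h2
  have h3 := even_colour_shift hn (-((f i).2 / (n : ℤ))) (f i)
  rw [← lift_proj, hv] at h3
  have h4 : outer (3 : Fin 4) = 1 := rfl
  have h5 : colour (f 0) = 0 := by rw [h.zero]; simp [colour, baseSquare, Square.lift]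
  have h6 : colour (Square.lift (⟨3, ⟨0, Nat.pos_of_ne_zero (NeZero.ne n)⟩⟩ : Square 4 n)) = 3 := by
    simp [colour, Square.lift]
  rw [h6] at h3
  rw [h5] at h1
  rw [Int.even_iff] at h1 h3
  dsimp only at h2
  omega

/-! ### The `3 × 4` board -/

/-- Whether the walk with vertices `l`, the last of which is `x`, extends by `k` new vertices to a
walk from whose end there is a step to `s`. -/
def closesUp (nbrs : ℕ → List ℕ) (s : ℕ) : ℕ → ℕ → List ℕ → Bool
  | 0, x, _ => (nbrs x).contains s
  | k + 1, x, l => (nbrs x).any fun y => !l.contains y && closesUp nbrs s k y (y :: l)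

/-- Soundness of the search: a Hamiltonian cycle would make it succeed, so the value `false`
excludes one. -/
theorem closesUp_of_walk {nbrs : ℕ → List ℕ} {N : ℕ} {v : ℕ → ℕ}
    (hv : ∀ i < N, v (i + 1) ∈ nbrs (v i)) (hinj : ∀ i < N, ∀ j < N, v i = v j → i = j)
    (hN : v N = v 0) (k j : ℕ) (hk : k + j + 1 = N) (l : List ℕ)
    (hl : ∀ x ∈ l, ∃ i ≤ j, x = v i) : closesUp nbrs (v 0) k (v j) l = true := by
  induction k generalizing j l with
  | zero =>
    rw [closesUp, List.contains_iff_mem, ← hN, ← hk, zero_add]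
    exact hv j (by omega)
  | succ k ih =>
    rw [closesUp, List.any_eq_true]
    refine ⟨v (j + 1), hv j (by omega), ?_⟩
    rw [Bool.and_eq_true]
    constructor
    · rw [Bool.not_eq_true', ← Bool.not_eq_true, List.contains_iff_mem]
      intro h
      obtain ⟨i, hi, h⟩ := hl _ h
      have := hinj _ (by omega) _ (by omega) h
      omega
    · refine ih (j + 1) (by omega) _ fun x hx => ?_
      rcases List.mem_cons.1 hx with rfl | hx
      · exact ⟨j + 1, le_rfl, rfl⟩
      · obtain ⟨i, hi, rfl⟩ := hl x hx
        exact ⟨i, by omega, rfl⟩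

/-- Numbers for the squares of the `3 × 4` board: the orbit of `(0, b)` in the strip gets the
number `b mod 8`, and the orbit of `(1, b)` gets `8 + (b mod 4)`. -/
def code (p : Fin 3 × ℤ) : ℕ :=
  if p.1 = 1 then 8 + (p.2 % 4).toNat else ((p.2 + 2 * (p.1 : ℕ)) % 8).toNat

/-- The numbers of the neighbours of a square of the `3 × 4` board. -/
def codeNbrs (x : ℕ) : List ℕ :=
  if x < 8 then [(x + 3) % 8, (x + 5) % 8, 8 + (x + 2) % 4] else [(x + 2) % 8, (x + 6) % 8]

theorem mem_codeNbrs {x y : ℕ} : y ∈ codeNbrs x ↔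
    (x < 8 ∧ (y = (x + 3) % 8 ∨ y = (x + 5) % 8 ∨ y = 8 + (x + 2) % 4)) ∨
      (8 ≤ x ∧ (y = (x + 2) % 8 ∨ y = (x + 6) % 8)) := by
  unfold codeNbrs
  split_ifs with h <;> simp [h] <;> omega

theorem code_shift (k : ℤ) (p : StripSquare 3) : code (shift 4 k p) = code p := by
  obtain ⟨a, b⟩ := p
  unfold code shift
  by_cases hk : Even k
  · simp only [if_pos hk]
    obtain ⟨l, rfl⟩ := hk
    fin_cases a <;> simp <;> omega
  · simp only [if_neg hk]
    obtain ⟨l, rfl⟩ := Int.not_even_iff_odd.1 hk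
    fin_cases a <;> simp [Fin.rev] <;> omega

theorem code_mem_codeNbrs {p q : StripSquare 3} (h : (stripGraph 3).Adj p q) :
    code q ∈ codeNbrs (code p) := by
  obtain ⟨a, b⟩ := p
  obtain ⟨c, d⟩ := q
  rcases h with ⟨h1, h2⟩ | ⟨h1, h2⟩ <;>
    rcases (abs_eq (by norm_num)).1 h2 with h2 | h2 <;> dsimp only at h1 h2 <;>
    obtain rfl := eq_add_of_sub_eq' h2 <;> clear h2 <;>
    fin_cases a <;> fin_cases c <;> simp at h1 <;>
    simp [code, mem_codeNbrs] <;> omega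

/-- The search takes place in the quotient graph, which has no Hamiltonian cycle at all, so here
homotopy plays no role. -/
theorem IsLiftedTour.not_three_four {f : ℕ → StripSquare 3} (h : IsLiftedTour (n := 4) f) :
    False := by
  have hcode : ∀ p : StripSquare 3, code (proj p : Square 3 4).lift = code p := fun p => by
    rw [lift_proj, code_shift]
  have hbij : Function.Bijective fun i : Fin (3 * 4) => (proj (f i) : Square 3 4) := by
    rw [Fintype.bijective_iff_surjective_and_card]
    refine ⟨fun v => ?_, by rw [card_square, Fintype.card_fin]⟩
    obtain ⟨i, hi, rfl⟩ := h.surj v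
    exact ⟨⟨i, hi⟩, rfl⟩
  have hcinj : ∀ u v : Square 3 4, code u.lift = code v.lift → u = v := by decide
  have h1 := closesUp_of_walk (nbrs := codeNbrs) (N := 12) (v := fun i => code (f i))
    (fun i hi => code_mem_codeNbrs (h.adj i hi))
    (fun i hi j hj hij => congrArg Fin.val (@hbij.1 ⟨i, hi⟩ ⟨j, hj⟩
      (hcinj _ _ (by rw [hcode, hcode]; exact hij))))
    (by rw [← h.closed]) 11 0 rfl [code (f 0)] (fun x hx => ⟨0, le_rfl, by simpa using hx⟩)
  have h2 : closesUp codeNbrs 0 11 0 [0] = false := by decide +kernel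
  have h3 : code (f 0) = 0 := by rw [h.zero]; rfl
  rw [h3, h2] at h1
  exact Bool.false_ne_true h1

/-- The boards that have no nullhomotopic tour. -/
theorem not_exists_tour [NeZero m] [NeZero n]
    (hmn : (Odd m ∧ Odd n ∧ (1 < m ∨ 1 < n)) ∨ (m = 1 ∧ 1 < n) ∨ m = 2 ∨ (m = 3 ∧ n = 4) ∨
      (m = 4 ∧ Odd n)) :
    ¬ ∃ p : Quiver.Path (baseSquare m n) (baseSquare m n), IsNullhomotopicTour p := by
  have hm : 0 < m := Nat.pos_of_ne_zero (NeZero.ne m)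
  have hn : 0 < n := Nat.pos_of_ne_zero (NeZero.ne n)
  intro h
  have h1 : 1 < m * n := by
    have : 1 < m ∨ 1 < n := by omega
    rcases this with h | h <;> nlinarith
  obtain ⟨f, hf, hback⟩ := exists_isLiftedTour h1 h
  rcases hmn with ⟨ho, ho', -⟩ | ⟨rfl, -⟩ | rfl | ⟨rfl, rfl⟩ | ⟨rfl, ho⟩
  · exact Nat.not_even_iff_odd.2 (ho.mul ho') hf.even_mul
  · exact absurd (hf.one_lt_width (n := n) (by omega)) (lt_irrefl 1)
  · exact not_closed_of_width_two (n := n) f (2 * n) (by omega) hf.adj hback hf.closed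
  · exact hf.not_three_four
  · exact Nat.not_even_iff_odd.2 ho hf.even_of_width_four

end MobiusKnight

namespace MobiusKnight

/-! ### Tours made of pieces -/

/-- Two squares of the plane are a knight's move apart. -/
def Knight (p q : ℤ × ℤ) : Prop :=
  (|q.1 - p.1| = 1 ∧ |q.2 - p.2| = 2) ∨ (|q.1 - p.1| = 2 ∧ |q.2 - p.2| = 1)

instance : DecidableRel Knight := fun _ _ => inferInstanceAs (Decidable (_ ∨ _))

theorem Knight.add_right {p q : ℤ × ℤ} (h : Knight p q) (t : ℤ × ℤ) : Knight (p + t) (q + t) := by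
  unfold Knight at h ⊢
  simpa using h

/-- The `i`-th power of the glide reflection `(x, y) ↦ (m - 1 - x, y + n)`. -/
def glide (m n i : ℤ) (p : ℤ × ℤ) : ℤ × ℤ := (if Even i then p.1 else m - 1 - p.1, p.2 + i * n)

theorem glide_glide (m n i j : ℤ) (p : ℤ × ℤ) :
    glide m n i (glide m n j p) = glide m n (i + j) p := by
  by_cases hi : Even i <;> by_cases hj : Even j <;> ext <;>
    simp [glide, hi, hj, Int.even_add] <;> ring

/-- A tour is cut into single squares and pairs of consecutive squares. In a pair both squares lie
in the two columns at the same border of the strip. -/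
inductive Piece : Type
  | single (p : ℤ × ℤ)
  | pair (p q : ℤ × ℤ)

namespace Piece

/-- The first square of a piece. -/
def first : Piece → ℤ × ℤ
  | single p => p
  | pair p _ => p

/-- The last square of a piece. -/
def last : Piece → ℤ × ℤ
  | single p => p
  | pair _ q => q

/-- The squares of a piece. -/
def cells : Piece → List (ℤ × ℤ)
  | single p => [p]
  | pair p q => [p, q]

/-- Whether a piece is a pair. -/
def isPair : Piece → Bool
  | single _ => false
  | pair _ _ => true

/-- A translate of a piece. -/
def translate (t : ℤ × ℤ) : Piece → Piece
  | single p => single (p + t)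
  | pair p q => pair (p + t) (q + t)

/-- The squares in pairs lie in the first `w` or the last `w` columns of the strip of width `m`, and
the single squares lie in the other columns. -/
def Valid (w m : ℤ) : Piece → Prop
  | single p => w ≤ p.1 ∧ p.1 < m - w
  | pair p q => Knight p q ∧ ((0 ≤ p.1 ∧ p.1 < w ∧ 0 ≤ q.1 ∧ q.1 < w) ∨
      (m - w ≤ p.1 ∧ p.1 < m ∧ m - w ≤ q.1 ∧ q.1 < m))

instance (w m : ℤ) : DecidablePred (Valid w m)
  | single _ => inferInstanceAs (Decidable (_ ∧ _))
  | pair _ _ => inferInstanceAs (Decidable (_ ∧ (_ ∨ _)))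

theorem first_translate (t : ℤ × ℤ) (s : Piece) : (s.translate t).first = s.first + t := by
  cases s <;> rfl

theorem last_translate (t : ℤ × ℤ) (s : Piece) : (s.translate t).last = s.last + t := by
  cases s <;> rfl

theorem cells_translate (t : ℤ × ℤ) (s : Piece) : (s.translate t).cells = s.cells.map (· + t) := by
  cases s <;> rfl

theorem isPair_translate (t : ℤ × ℤ) (s : Piece) : (s.translate t).isPair = s.isPair := by
  cases s <;> rfl

theorem Valid.translate {w m : ℤ} {s : Piece} (h : s.Valid w m) (y : ℤ) :
    (s.translate (0, y)).Valid w m := by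
  cases s with
  | single p => simpa [Valid, Piece.translate] using h
  | pair p q => exact ⟨h.1.add_right _, by simpa [Valid, Piece.translate] using h.2⟩

theorem Valid.mem_strip {w m : ℤ} {s : Piece} (hw : 0 ≤ w) (hm : w ≤ m) (h : s.Valid w m)
    {p : ℤ × ℤ} (hp : p ∈ s.cells) : 0 ≤ p.1 ∧ p.1 < m := by
  cases s with
  | single q =>
    simp only [cells, List.mem_singleton] at hp
    subst hp
    simp only [Valid] at h
    omega
  | pair q r =>
    simp only [cells, List.mem_cons, List.not_mem_nil, or_false] at hp
    simp only [Valid] at h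
    rcases hp with rfl | rfl <;> omega

end Piece

/-- `IsWalk a T b` says that the pieces in `T`, one after the other, form a walk from `a` to `b`. -/
inductive IsWalk : ℤ × ℤ → List Piece → ℤ × ℤ → Prop
  | singleton (s : Piece) : IsWalk s.first [s] s.last
  | cons (s : Piece) {T : List Piece} {c d : ℤ × ℤ} :
      Knight s.last c → IsWalk c T d → IsWalk s.first (s :: T) d

theorem IsWalk.append {T U : List Piece} {a b c d : ℤ × ℤ} (hT : IsWalk a T b) (h : Knight b c)
    (hU : IsWalk c U d) : IsWalk a (T ++ U) d := by
  induction hT with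
  | singleton s => exact .cons s h hU
  | cons s hs _ ih => exact .cons s hs (ih h)

/-- Pieces may be replaced by walks whose ends are moved by one common vector, since the moves
between pieces are then only translated. -/
theorem IsWalk.flatMap {T : List Piece} {a b : ℤ × ℤ} (hT : IsWalk a T b)
    {g : Piece → List Piece} (t : ℤ × ℤ)
    (hg : ∀ s ∈ T, IsWalk (s.first + t) (g s) (s.last + t)) :
    IsWalk (a + t) (T.flatMap g) (b + t) := by
  induction hT with
  | singleton s => simpa using hg s (by simp)
  | cons s hs _ ih =>
    rw [List.flatMap_cons]
    exact (hg s (by simp)).append (hs.add_right t) (ih fun u hu => hg u (by simp [hu]))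

theorem IsWalk.translate {T : List Piece} {a b : ℤ × ℤ} (hT : IsWalk a T b) (t : ℤ × ℤ) :
    IsWalk (a + t) (T.map (Piece.translate t)) (b + t) := by
  rw [List.map_eq_flatMap]
  refine hT.flatMap t fun s _ => ?_
  rw [← Piece.first_translate, ← Piece.last_translate]
  exact .singleton _

/-- The squares of a list of pieces. -/
def cells (T : List Piece) : List (ℤ × ℤ) := T.flatMap Piece.cells

theorem cells_append (T U : List Piece) : cells (T ++ U) = cells T ++ cells U :=
  List.flatMap_append

theorem cells_translate (t : ℤ × ℤ) (T : List Piece) :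
    cells (T.map (Piece.translate t)) = (cells T).map (· + t) := by
  simp [cells, List.flatMap_map, List.map_flatMap, Piece.cells_translate]

/-- The pieces form a tour of the `m × n` Möbius board, and every square of the first and last `w`
columns lies in a pair. -/
structure IsPieceTour (w m n : ℕ) (T : List Piece) : Prop where
  valid : ∀ s ∈ T, s.Valid w m
  closed : ∃ a b, IsWalk a T b ∧ Knight b a
  length : (cells T).length = m * n
  covers : ∀ p : ℤ × ℤ, 0 ≤ p.1 → p.1 < m → ∃ i, glide m n i p ∈ cells T
  pairs : T.countP Piece.isPair = w * n

/-! ### Adding two columns at either border -/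

/-- Add two columns at either border of the strip, and in a pair `p, q` make a detour through the
translates of `p` and `q` by the knight's move `(∓2, 1)` into the new columns. -/
def widen : Piece → List Piece
  | .single p => [.single (p + (2, 0))]
  | .pair p q => [.single (p + (2, 0)),
      .pair (p + if p.1 < 2 then (0, 1) else (4, 1)) (q + if p.1 < 2 then (0, 1) else (4, 1)),
      .single (q + (2, 0))]

/-- The detours translate the old border columns onto the new ones, one row higher. This translation
is compatible with the glide reflection, which exchanges the two borders, so the new border orbits
are covered because the old ones were. The bound `4 ≤ m` keeps the two borders disjoint. -/
theorem IsPieceTour.widen {m n : ℕ} {T : List Piece} (h : IsPieceTour 2 m n T) (hm : 4 ≤ m) :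
    IsPieceTour 2 (m + 4) n (T.flatMap widen) := by
  have hpair : ∀ p q, .pair p q ∈ T → Knight p q ∧
      ((0 ≤ p.1 ∧ p.1 < 2 ∧ 0 ≤ q.1 ∧ q.1 < 2) ∨
        (m - 2 ≤ p.1 ∧ p.1 < m ∧ m - 2 ≤ q.1 ∧ q.1 < (m : ℤ))) := fun p q hpq => h.valid _ hpq
  have hcells : ∀ p ∈ cells T, p + (2, 0) ∈ cells (T.flatMap MobiusKnight.widen) := by
    intro p hp
    obtain ⟨s, hs, hp⟩ := List.mem_flatMap.1 hp
    refine List.mem_flatMap.2 ⟨.single (p + (2, 0)), List.mem_flatMap.2 ⟨s, hs, ?_⟩, by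
      simp [Piece.cells]⟩
    cases s with
    | single q => simp_all [Piece.cells, MobiusKnight.widen]
    | pair q r =>
      simp only [Piece.cells, List.mem_cons, List.not_mem_nil, or_false] at hp
      rcases hp with rfl | rfl <;> simp [MobiusKnight.widen]
  have hborder : ∀ p ∈ cells T, p.1 < 2 ∨ m - 2 ≤ p.1 →
      (p + if p.1 < 2 then (0, 1) else (4, 1)) ∈ cells (T.flatMap MobiusKnight.widen) := by
    intro p hp hp'
    obtain ⟨s, hs, hp⟩ := List.mem_flatMap.1 hp
    cases s with
    | single q =>
      have h1 := h.valid _ hs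
      simp only [Piece.cells, List.mem_singleton] at hp
      subst hp
      simp only [Piece.Valid] at h1
      push_cast at h1
      omega
    | pair q r =>
      have h1 := (hpair q r hs).2
      refine List.mem_flatMap.2 ⟨_, List.mem_flatMap.2 ⟨_, hs, List.mem_cons_of_mem _
        List.mem_cons_self⟩, ?_⟩
      simp only [Piece.cells, List.mem_cons, List.not_mem_nil, or_false] at hp ⊢
      rcases hp with rfl | rfl
      · exact Or.inl rfl
      · right
        congr 1
        -- The detour vector is chosen from the first square of the pair; the second lies at the
        -- same border.
        by_cases hq : q.1 < 2
        · rw [if_pos hq, if_pos (by omega)]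
        · rw [if_neg hq, if_neg (by omega)]
  constructor
  · intro s hs
    obtain ⟨t, ht, hs⟩ := List.mem_flatMap.1 hs
    have h1 := h.valid t ht
    cases t with
    | single p =>
      simp only [MobiusKnight.widen, List.mem_singleton] at hs
      subst hs
      simp only [Piece.Valid, Prod.fst_add] at h1 ⊢
      push_cast at h1 ⊢
      omega
    | pair p q =>
      obtain ⟨hk, h1⟩ := hpair p q ht
      simp only [MobiusKnight.widen, List.mem_cons, List.not_mem_nil, or_false] at hs
      rcases hs with rfl | rfl | rfl
      · simp only [Piece.Valid, Prod.fst_add]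
        push_cast
        omega
      · refine ⟨hk.add_right _, ?_⟩
        split_ifs <;> simp only [Prod.fst_add] <;> push_cast <;> omega
      · simp only [Piece.Valid, Prod.fst_add]
        push_cast
        omega
  · obtain ⟨a, b, hab, hba⟩ := h.closed
    refine ⟨a + (2, 0), b + (2, 0), hab.flatMap (2, 0) fun s hs => ?_, hba.add_right _⟩
    cases s with
    | single p => exact .singleton (.single _)
    | pair p q =>
      have hk : ∀ r : ℤ × ℤ, Knight (r + (2, 0)) (r + if p.1 < 2 then (0, 1) else (4, 1)) := by
        intro r
        split_ifs <;> simp [Knight]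
      have hk' : ∀ r : ℤ × ℤ, Knight (r + if p.1 < 2 then (0, 1) else (4, 1)) (r + (2, 0)) := by
        intro r
        split_ifs <;> simp [Knight]
      exact .cons (.single _) (hk p) (.cons (.pair _ _) (hk' q) (.singleton (.single _)))
  -- Each of the `2 * n` pairs contributes two further squares: in all `4 * n`, the size of four new
  -- columns.
  · have key : ∀ U : List Piece, (cells (U.flatMap MobiusKnight.widen)).length =
        (cells U).length + 2 * U.countP Piece.isPair := by
      intro U
      induction U with
      | nil => rfl
      | cons s U ih =>
        rw [List.flatMap_cons, cells_append, List.length_append, ih, List.countP_cons]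
        cases s <;>
          simp [cells, Piece.cells, MobiusKnight.widen, Piece.isPair] <;> omega
    rw [key, h.length, h.pairs]
    ring
  · intro p hp0 hp1
    push_cast at hp1
    by_cases hc : 2 ≤ p.1 ∧ p.1 < m + 2
    · obtain ⟨i, hi⟩ := h.covers (p.1 - 2, p.2) (by dsimp only; omega) (by dsimp only; omega)
      refine ⟨i, ?_⟩
      convert hcells _ hi using 1
      by_cases he : Even i <;> ext <;> simp [glide, he]
      ring
    -- The old border square whose detour translate is `p`.
    · obtain ⟨i, hi⟩ := h.covers (if p.1 < 2 then p.1 else p.1 - 4, p.2 - 1)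
        (by dsimp only; split_ifs <;> omega) (by dsimp only; split_ifs <;> omega)
      refine ⟨i, ?_⟩
      convert hborder _ hi ?_ using 1
      · by_cases he : Even i <;> by_cases h2 : p.1 < 2 <;> simp only [glide, he, h2, if_true, if_false]
        · ext <;> simp
          ring
        · rw [if_neg (by omega)]
          ext <;> simp
          ring
        · rw [if_neg (by omega)]
          ext <;> simp <;> ring
        · rw [if_pos (by omega)]
          ext <;> simp <;> ring
      · simp only [glide]
        split_ifs <;> omega
  · have key : ∀ U : List Piece, (U.flatMap MobiusKnight.widen).countP Piece.isPair =
        U.countP Piece.isPair := by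
      intro U
      induction U with
      | nil => rfl
      | cons s U ih =>
        rw [List.flatMap_cons, List.countP_append, ih, List.countP_cons]
        cases s <;> simp [MobiusKnight.widen, Piece.isPair, List.countP_cons] <;> omega
    rw [key, h.pairs]

end MobiusKnight

namespace MobiusKnight

/-! ### Adding rows -/

/-- Prolong a tour by `j` translates of the walks `P` and `Q`. -/
def prolong (τ : ℤ) (T P Q : List Piece) : ℕ → List Piece
  | 0 => T
  | j + 1 => Q.map (Piece.translate (0, j * τ)) ++ prolong τ T P Q j ++
      P.map (Piece.translate (0, j * τ))

theorem subset_cells_prolong (τ : ℤ) (T P Q : List Piece) (j : ℕ) :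
    ∀ p ∈ cells T, p ∈ cells (prolong τ T P Q j) := by
  induction j with
  | zero => exact fun p hp => hp
  | succ j ih =>
    intro p hp
    simp [prolong, cells_append, ih p hp]

theorem add_mem_cells_prolong (τ : ℤ) (T P Q : List Piece) (j : ℕ) :
    ∀ p ∈ cells (P ++ Q), ∀ i : ℕ, i < j → p + (0, i * τ) ∈ cells (prolong τ T P Q j) := by
  induction j with
  | zero => intro p _ i hi; omega
  | succ j ih =>
    intro p hp i hi
    rw [prolong, cells_append, cells_append, cells_translate, cells_translate, List.mem_append,
      List.mem_append]
    rcases (Nat.lt_succ_iff.1 hi).lt_or_eq with hi | rfl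
    · exact Or.inl (Or.inr (ih p hp i hi))
    · rw [cells_append, List.mem_append] at hp
      rcases hp with hp | hp
      · exact Or.inr (List.mem_map_of_mem hp)
      · exact Or.inl (Or.inl (List.mem_map_of_mem hp))

/-- If `C` meets every orbit of the glide reflection by `n`, up to rows that are covered by
translates of `D`, then `C` together with `j` translates of `D` meets every orbit of the glide
reflection by `n + j * k`. -/
theorem exists_glide_mem {m n k e : ℤ} (hn : 0 < n) (hk : 0 < k) (he : e = 1 ∨ e = 2)
    {C D : List (ℤ × ℤ)}
    (hC : ∀ p ∈ D, ∃ c : ℕ, glide m n (-e) p + (0, c * (e * k)) ∈ D ∧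
      ∀ i < c, glide m n (-e) p + (0, i * (e * k)) ∈ C)
    (hD : ∀ p : ℤ × ℤ, 0 ≤ p.1 → p.1 < m → ∃ l, (l = 0 ∨ l = 1) ∧ ∀ t, (t = 0 ∨ t = l) →
      ∃ q ∈ D, (glide m n (-e) q).1 = (glide m n l p).1 ∧
        e * k ∣ (glide m n (-e) q).2 - ((glide m n l p).2 + t * k))
    {F : List (ℤ × ℤ)} (j : ℕ) (hCF : ∀ p ∈ C, p ∈ F)
    (hDF : ∀ p ∈ D, ∀ i : ℕ, i < j → p + (0, i * (e * k)) ∈ F) (p : ℤ × ℤ) (hp0 : 0 ≤ p.1)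
    (hp1 : p.1 < m) : ∃ i, glide m (n + j * k) i p ∈ F := by
  have hτ : 0 < e * k := by rcases he with rfl | rfl <;> omega
  have hN : 0 < n + j * k := by positivity
  obtain ⟨L, hL⟩ : ∃ L : ℤ, ∀ p ∈ D, L ≤ (glide m n (-e) p).2 := by
    obtain ⟨L, hL⟩ := ((D.toFinset.image fun p => (glide m n (-e) p).2).finite_toSet).bddBelow
    exact ⟨L, fun p hp => hL (by simpa using ⟨p.1, p.2, hp, rfl⟩)⟩
  -- Go up from `glide m n (-e) p` in steps of `e * k`. The first `c₀` squares lie in `C`, the next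
  -- `j` are the available translates of an element of `D`. Beyond these, the `-e`-th power of the
  -- new glide reflection lowers by `e * n` plus exactly `j` steps, and so leads to a square of the
  -- same kind.
  have step : ∀ (p) (_ : p ∈ D) (c : ℕ), glide m n (-e) p + (0, c * (e * k)) ∈ F ∨
      ∃ q ∈ D, ∃ d : ℕ, glide m (n + j * k) (-e) (glide m n (-e) p + (0, c * (e * k))) =
        glide m n (-e) q + (0, d * (e * k)) := by
    intro p hp c
    obtain ⟨c₀, h1, h2⟩ := hC p hp
    rcases lt_or_ge c c₀ with hc | hc
    · exact Or.inl (hCF _ (h2 c hc))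
    obtain ⟨d, rfl⟩ := Nat.exists_eq_add_of_le hc
    have h3 : glide m n (-e) p + (0, ((c₀ + d : ℕ) : ℤ) * (e * k)) =
        glide m n (-e) p + (0, c₀ * (e * k)) + (0, d * (e * k)) := by
      ext <;> simp
      ring
    rw [h3]
    rcases lt_or_ge d j with hd | hd
    · exact Or.inl (hDF _ h1 d hd)
    obtain ⟨d, rfl⟩ := Nat.exists_eq_add_of_le hd
    refine Or.inr ⟨_, h1, d, ?_⟩
    generalize glide m n (-e) p + (0, c₀ * (e * k)) = q
    ext
    · simp [glide]
    · simp [glide]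
      ring
  -- Each use of the second alternative of `step` lowers the row by `e * (n + j * k) > 0`, while
  -- rows stay at or above `L`; hence the descent ends in `F`.
  have climb : ∀ (t : ℕ), ∀ p ∈ D, ∀ c : ℕ, (glide m n (-e) p).2 + c * (e * k) < L + t →
      ∃ i, glide m (n + j * k) i (glide m n (-e) p + (0, c * (e * k))) ∈ F := by
    intro t
    induction t with
    | zero =>
      intro p hp c h
      have := hL p hp
      have : 0 ≤ (c : ℤ) * (e * k) := by positivity
      omega
    | succ t ih =>
      intro p hp c h
      rcases step p hp c with h1 | ⟨q, hq, d, h1⟩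
      · exact ⟨0, by simpa [glide] using h1⟩
      · have h2 := congrArg Prod.snd h1
        simp only [glide, Prod.snd_add] at h2 h
        obtain ⟨i, hi⟩ := ih q hq d (by
          have h3 : n + j * k ≤ e * (n + j * k) := by
            rcases he with rfl | rfl <;> omega
          simp only [glide]
          push_cast at h
          linarith)
        rw [← h1, glide_glide] at hi
        exact ⟨_, hi⟩
  have start : ∀ z : ℤ × ℤ, (∃ q ∈ D, (glide m n (-e) q).1 = z.1 ∧
      e * k ∣ (glide m n (-e) q).2 - z.2) → ∃ i, glide m (n + j * k) i z ∈ F := by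
    rintro z ⟨q, hq, h1, h2⟩
    set s := glide m n (-e) q with hs
    let N := n + j * k
    let T := |s.2 - z.2|
    -- The power `2 * (e * k) * T` of the glide reflection is even, so it keeps the column; it keeps
    -- the row modulo `e * k`; and it lifts `z` by at least `T`, so to row `s.2` or above.
    have h3 : 0 ≤ z.2 + 2 * (e * k) * T * N - s.2 := by
      have h4 : T ≤ 2 * (e * k) * T * N := by
        have : 1 ≤ (e * k) * N := Int.add_one_le_of_lt (mul_pos hτ hN)
        nlinarith [abs_nonneg (s.2 - z.2)]
      have := le_abs_self (s.2 - z.2)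
      linarith
    have h5 : e * k ∣ z.2 + 2 * (e * k) * T * N - s.2 := by
      have : z.2 + 2 * (e * k) * T * N - s.2 = (e * k) * (2 * T * N) - (s.2 - z.2) := by ring
      rw [this]
      exact dvd_sub (dvd_mul_right _ _) h2
    obtain ⟨c, hc⟩ := h5
    have hc0 : 0 ≤ c := by
      by_contra! h6
      nlinarith
    lift c to ℕ using hc0
    have h7 : glide m N (2 * ((e * k) * T)) z = s + (0, c * (e * k)) := by
      ext
      · simp [glide, h1]
      · simp only [glide, Prod.snd_add]
        linarith
    obtain ⟨i, hi⟩ := climb ((s.2 + c * (e * k) - L).toNat + 1) q hq c (by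
      push_cast
      have := Int.self_le_toNat (s.2 + c * (e * k) - L)
      linarith)
    rw [← hs, ← h7, glide_glide] at hi
    exact ⟨_, hi⟩
  obtain ⟨l, hl, hl'⟩ := hD p hp0 hp1
  have : ∃ i, glide m (n + j * k) i (glide m (n + j * k) l p) ∈ F := by
    refine start _ ?_
    rcases hl with rfl | rfl
    · obtain ⟨q, hq, h1, h2⟩ := hl' 0 (Or.inl rfl)
      exact ⟨q, hq, h1, by simpa [glide] using h2⟩
    -- One new glide raises by `n + j * k`. As `e * k` divides `2 * k`, only the parity of `j`
    -- matters: this is the role of `t`.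
    · rcases Nat.even_or_odd' j with ⟨a, rfl | rfl⟩
      · obtain ⟨q, hq, h1, h2⟩ := hl' 0 (Or.inl rfl)
        refine ⟨q, hq, h1, ?_⟩
        have h3 : (glide m n (-e) q).2 - (glide m (n + ((2 * a : ℕ) : ℤ) * k) 1 p).2 =
            (glide m n (-e) q).2 - ((glide m n 1 p).2 + 0 * k) - 2 * k * a := by
          simp only [glide]
          push_cast
          ring
        rw [h3]
        refine dvd_sub h2 (Dvd.dvd.mul_right (mul_dvd_mul_right ?_ k) _)
        rcases he with rfl | rfl <;> decide
      · obtain ⟨q, hq, h1, h2⟩ := hl' 1 (Or.inr rfl)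
        refine ⟨q, hq, h1, ?_⟩
        have h3 : (glide m n (-e) q).2 - (glide m (n + ((2 * a + 1 : ℕ) : ℤ) * k) 1 p).2 =
            (glide m n (-e) q).2 - ((glide m n 1 p).2 + 1 * k) - 2 * k * a := by
          simp only [glide]
          push_cast
          ring
        rw [h3]
        refine dvd_sub h2 (Dvd.dvd.mul_right (mul_dvd_mul_right ?_ k) _)
        rcases he with rfl | rfl <;> decide
  obtain ⟨i, hi⟩ := this
  rw [glide_glide] at hi
  exact ⟨_, hi⟩

end MobiusKnight

namespace MobiusKnight

/-! ### Seeds: finite data that generate infinite families of tours -/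

instance decidableIsWalk : ∀ a T b, Decidable (IsWalk a T b)
  | _, [], _ => isFalse fun h => by cases h
  | a, [s], b => decidable_of_iff (a = s.first ∧ b = s.last)
      ⟨fun ⟨ha, hb⟩ => ha ▸ hb ▸ .singleton s, fun h => by
        cases h with
        | singleton => exact ⟨rfl, rfl⟩
        | cons _ _ h => cases h⟩
  | a, s :: t :: T, b =>
    have := decidableIsWalk t.first (t :: T) b
    decidable_of_iff (a = s.first ∧ Knight s.last t.first ∧ IsWalk t.first (t :: T) b)
      ⟨fun ⟨ha, hk, hw⟩ => ha ▸ .cons s hk hw, fun h => by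
        cases h with
        | cons _ hk hw => cases hw with
          | singleton => exact ⟨rfl, hk, .singleton _⟩
          | cons _ hk' hw => exact ⟨rfl, hk, .cons _ hk' hw⟩⟩

/-- A tour `T` of the `m × n` Möbius board from `a` to `b`, and walks `P` from a neighbour `c` of `b`
to `b + (0, e * k)` and `Q` from `a + (0, e * k)` to a neighbour `d` of `a`, such that the translates
of `P` and `Q` prolong `T` to tours of the `m × (n + j * k)` Möbius boards. -/
structure IsSeed (w m n k e : ℕ) (T P Q : List Piece) (a b c d : ℤ × ℤ) : Prop where
  valid : ∀ s ∈ T ++ (P ++ Q), s.Valid w m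
  walk : IsWalk a T b ∧ IsWalk c P (b + (0, (e * k : ℤ))) ∧ IsWalk (a + (0, (e * k : ℤ))) Q d
  knight : Knight b a ∧ Knight b c ∧ Knight d a
  length : (cells T).length = m * n ∧ (cells (P ++ Q)).length = m * k
  pairs : T.countP Piece.isPair = w * n ∧ (P ++ Q).countP Piece.isPair = w * k
  -- This and the next field are the finite forms of the hypotheses of `exists_glide_mem`. The bound
  -- 8 only makes the search finite.
  descend : ∀ p ∈ cells (P ++ Q), ∃ c ∈ List.range 8,
    glide m n (-e) p + (0, c * (e * k : ℤ)) ∈ cells (P ++ Q) ∧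
      ∀ i ∈ List.range c, glide m n (-e) p + (0, i * (e * k : ℤ)) ∈ cells T
  residues : ∀ x ∈ List.range m, ∀ r ∈ List.range (e * k), ∃ l ∈ List.range 2,
    ∀ t ∈ List.range (l + 1), ∃ q ∈ cells (P ++ Q),
      (glide m n (-e) q).1 = (glide m n l (x, r)).1 ∧
        (e * k : ℤ) ∣ (glide m n (-e) q).2 - ((glide m n l (x, r)).2 + t * k)

instance (w m n k e : ℕ) (T P Q : List Piece) (a b c d : ℤ × ℤ) :
    Decidable (IsSeed w m n k e T P Q a b c d) :=
  decidable_of_iff (_ ∧ _ ∧ _ ∧ _ ∧ _ ∧ _ ∧ _)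
    ⟨fun ⟨h1, h2, h3, h4, h5, h6, h7⟩ => ⟨h1, h2, h3, h4, h5, h6, h7⟩,
      fun ⟨h1, h2, h3, h4, h5, h6, h7⟩ => ⟨h1, h2, h3, h4, h5, h6, h7⟩⟩

/-- Attaching `Q` before and `P` after moves both ends up by `e * k`, so the closing move is
translated and the next translates of `Q` and `P` fit again. -/
theorem IsSeed.isPieceTour {w m n k e : ℕ} {T P Q : List Piece} {a b c d : ℤ × ℤ}
    (h : IsSeed w m n k e T P Q a b c d) (hn : 0 < n) (hk : 0 < k) (he : e = 1 ∨ e = 2) (j : ℕ) :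
    IsPieceTour w m (n + j * k) (prolong (e * k) T P Q j) := by
  constructor
  · induction j with
    | zero => exact fun s hs => h.valid s (by simp [show s ∈ T from hs])
    | succ j ih =>
      intro s hs
      simp only [prolong, List.mem_append, List.mem_map] at hs
      rcases hs with (⟨t, ht, rfl⟩ | hs) | ⟨t, ht, rfl⟩
      · exact (h.valid t (by simp [ht])).translate _
      · exact ih s hs
      · exact (h.valid t (by simp [ht])).translate _
  · refine ⟨a + (0, j * (e * k : ℤ)), b + (0, j * (e * k : ℤ)), ?_, h.knight.1.add_right _⟩
    have hj : ∀ (q : ℤ × ℤ) (j : ℕ), q + (0, ((j + 1 : ℕ) : ℤ) * (e * k)) =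
        q + (0, (e * k : ℤ)) + (0, j * (e * k : ℤ)) := fun q j => by
      ext
      · simp
      · simp only [Prod.snd_add]
        push_cast
        ring
    induction j with
    | zero =>
      have h0 : ∀ q : ℤ × ℤ, q + (0, ((0 : ℕ) : ℤ) * (e * k)) = q := fun q => by ext <;> simp
      rw [h0, h0]
      exact h.walk.1
    | succ j ih =>
      rw [hj, hj, prolong]
      exact ((h.walk.2.2.translate _).append (h.knight.2.2.add_right _) ih).append
        (h.knight.2.1.add_right _) (h.walk.2.1.translate _)
  · induction j with
    | zero => simpa [prolong] using h.length.1
    | succ j ih =>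
      have h1 := h.length.2
      rw [cells_append, List.length_append] at h1
      simp only [prolong, cells_append, cells_translate, List.length_append, List.length_map, ih]
      rw [add_right_comm, add_comm (cells Q).length, h1]
      ring
  · have hk' : (0 : ℤ) < k := by exact_mod_cast hk
    have hτ : (0 : ℤ) < e * k := by rcases he with rfl | rfl <;> push_cast <;> omega
    intro p hp0 hp1
    have key := exists_glide_mem (m := m) (n := n) (k := k) (e := e) (by exact_mod_cast hn) hk'
      (by exact_mod_cast he) (C := cells T) (D := cells (P ++ Q)) (fun p hp => ?_)
      (fun p hp0 hp1 => ?_) (F := cells (prolong (e * k) T P Q j)) j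
      (subset_cells_prolong _ T P Q j) (add_mem_cells_prolong _ T P Q j) p hp0 hp1
    · simpa using key
    · obtain ⟨c, -, h1, h2⟩ := h.descend p hp
      exact ⟨c, h1, fun i hi => h2 i (List.mem_range.2 hi)⟩
    · have hr0 := Int.emod_nonneg p.2 hτ.ne'
      have hr1 := Int.emod_lt_of_pos p.2 hτ
      have hr2 := Int.emod_add_mul_ediv p.2 (e * k)
      obtain ⟨l, hl, h1⟩ := h.residues p.1.toNat (List.mem_range.2 (by omega))
        (p.2 % (e * k)).toNat (List.mem_range.2 (by zify; omega))
      rw [Int.toNat_of_nonneg hp0, Int.toNat_of_nonneg hr0] at h1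
      have hl' : l = 0 ∨ l = 1 := by
        have := List.mem_range.1 hl
        omega
      refine ⟨l, by exact_mod_cast hl', ?_⟩
      have h2 : ∀ t : ℕ, t ∈ List.range (l + 1) → ∃ q ∈ cells (P ++ Q),
          (glide m n (-e) q).1 = (glide m n l p).1 ∧
            (e * k : ℤ) ∣ (glide m n (-e) q).2 - ((glide m n l p).2 + t * k) := by
        intro t ht
        obtain ⟨q, hq, h3, h4⟩ := h1 t ht
        refine ⟨q, hq, h3, ?_⟩
        have h5 : (glide m n (-e) q).2 - ((glide m n l p).2 + t * k) =
            (glide m n (-e) q).2 - ((glide m n l (p.1, p.2 % (e * k))).2 + t * k) -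
              (e * k) * (p.2 / (e * k)) := by
          simp only [glide]
          linarith
        rw [h5]
        exact dvd_sub h4 (dvd_mul_right _ _)
      rintro t (rfl | rfl)
      · exact_mod_cast h2 0 (by simp)
      · exact h2 l (by simp)
  · induction j with
    | zero => simpa [prolong] using h.pairs.1
    | succ j ih =>
      have h1 := h.pairs.2
      rw [List.countP_append] at h1
      have ht : ∀ (t : ℤ × ℤ) (U : List Piece),
          (U.map (Piece.translate t)).countP Piece.isPair = U.countP Piece.isPair := fun t U => by
        rw [List.countP_map]
        exact List.countP_congr fun s _ => by simp [Piece.isPair_translate]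
      simp only [prolong, List.countP_append, ht, ih]
      rw [add_right_comm, add_comm (Q.countP _), h1]
      ring

/-- The rectangle meets every orbit. The offset 8 lets the search over naturals include negative
powers. -/
theorem exists_glide_mem_of_rectangle {m n : ℕ} (hn : 0 < n) {F : List (ℤ × ℤ)} {B : ℕ}
    (h : ∀ x ∈ List.range m, ∀ y ∈ List.range n, ∃ i ∈ List.range B,
      glide m n (i - 8) (x, y) ∈ F) (p : ℤ × ℤ) (hp0 : 0 ≤ p.1) (hp1 : p.1 < m) :
    ∃ i, glide m n i p ∈ F := by
  have hn' : (0 : ℤ) < n := by exact_mod_cast hn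
  have hq0 : 0 ≤ (glide m n (-(p.2 / n)) p).1 ∧ (glide m n (-(p.2 / n)) p).1 < m := by
    simp only [glide]
    split_ifs <;> omega
  have hq1 : (glide m n (-(p.2 / n)) p).2 = p.2 % n := by
    simp only [glide]
    linarith [Int.emod_add_mul_ediv p.2 n]
  have hr0 := Int.emod_nonneg p.2 hn'.ne'
  have hr1 := Int.emod_lt_of_pos p.2 hn'
  obtain ⟨i, -, hi⟩ := h (glide m n (-(p.2 / n)) p).1.toNat (List.mem_range.2 (by omega))
    (glide m n (-(p.2 / n)) p).2.toNat (List.mem_range.2 (by omega))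
  rw [Int.toNat_of_nonneg hq0.1, Int.toNat_of_nonneg (hq1 ▸ hr0), Prod.mk.eta, glide_glide] at hi
  exact ⟨_, hi⟩

/-! ### From pieces to tours -/

theorem IsWalk.map_cells {T : List Piece} {a b : ℤ × ℤ} (hT : IsWalk a T b)
    (hK : ∀ p q, .pair p q ∈ T → Knight p q) : IsWalk a ((cells T).map .single) b := by
  have h := hT.flatMap (g := fun s => s.cells.map .single) 0 fun s hs => by
    rw [add_zero, add_zero]
    cases s with
    | single p => exact .singleton (.single p)
    | pair p q => exact .cons (.single p) (hK p q hs) (.singleton (.single q))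
  rw [add_zero, add_zero] at h
  simpa [cells, List.map_flatMap] using h

theorem IsWalk.exists_seq {l : List (ℤ × ℤ)} {a b : ℤ × ℤ} (h : IsWalk a (l.map .single) b)
    (hba : Knight b a) : ∃ g : ℕ → ℤ × ℤ, (∀ i, Knight (g i) (g (i + 1))) ∧
      (∀ i, g (i + l.length) = g i) ∧ ∀ p, p ∈ l ↔ ∃ i < l.length, g i = p := by
  have h1 : l.IsChain Knight ∧ l.head? = some a ∧ l.getLast? = some b := by
    clear hba
    induction l generalizing a with
    | nil => cases h
    | cons p l ih =>
      rw [List.map_cons] at h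
      cases l with
      | nil =>
        cases h with
        | singleton => simp [Piece.first, Piece.last]
        | cons _ _ h => cases h
      | cons q l =>
        cases h with
        | cons _ hk h =>
          obtain ⟨h2, h3, h4⟩ := ih h
          simp only [List.head?_cons, Option.some.injEq] at h3
          subst h3
          exact ⟨List.isChain_cons_cons.2 ⟨hk, h2⟩, rfl, by simpa using h4⟩
  obtain ⟨hl, hhead, hlast⟩ := h1
  have hpos : 0 < l.length := by
    cases l with
    | nil => simp at hhead
    | cons => simp
  have hlt : ∀ i, i % l.length < l.length := fun i => Nat.mod_lt _ hpos
  refine ⟨fun i => l[i % l.length]'(hlt i), fun i => ?_, fun i => ?_, fun p => ?_⟩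
  · rcases (show i % l.length + 1 ≤ l.length from hlt i).lt_or_eq with h2 | h2
    · have h3 : (i + 1) % l.length = i % l.length + 1 := by
        rw [Nat.add_mod, Nat.mod_eq_of_lt (a := 1) (by omega), Nat.mod_eq_of_lt h2]
      simp only [h3]
      exact List.isChain_iff_getElem.1 hl _ h2
    · have h3 : (i + 1) % l.length = 0 := by
        rw [← Nat.mod_add_mod, h2, Nat.mod_self]
      have h4 : i % l.length = l.length - 1 := by omega
      simp only [h3, h4]
      rw [List.getLast?_eq_getElem?, List.getElem?_eq_getElem (by omega), Option.some.injEq] at hlast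
      rw [List.head?_eq_getElem?, List.getElem?_eq_getElem hpos, Option.some.injEq] at hhead
      rwa [hlast, hhead]
  · simp only [Nat.add_mod_right]
  · rw [List.mem_iff_getElem]
    constructor
    · rintro ⟨i, hi, rfl⟩
      exact ⟨i, hi, by simp only [Nat.mod_eq_of_lt hi]⟩
    · rintro ⟨i, -, rfl⟩
      exact ⟨_, hlt i, rfl⟩

/-- The tour is read as a periodic sequence. It need not meet `(0, 0)` itself, only its orbit, so it
is rotated to that time `t₀` and moved by a deck transformation. -/
theorem IsPieceTour.exists_isLiftedTour {w m n : ℕ} [NeZero m] [NeZero n] {T : List Piece}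
    (h : IsPieceTour w m n T) (hw : w ≤ m) : ∃ f : ℕ → StripSquare m, IsLiftedTour (n := n) f := by
  obtain ⟨a, b, hab, hba⟩ := h.closed
  have hK : ∀ p q, .pair p q ∈ T → Knight p q := fun p q hpq => (h.valid _ hpq).1
  obtain ⟨g, hg, hper, hmem⟩ := (hab.map_cells hK).exists_seq hba
  have hstrip : ∀ p ∈ cells T, 0 ≤ p.1 ∧ p.1 < m := fun p hp => by
    obtain ⟨s, hs, hp⟩ := List.mem_flatMap.1 hp
    exact (h.valid s hs).mem_strip (by omega) (by omega) hp
  rw [h.length] at hper hmem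
  have hN : 0 < m * n := Nat.mul_pos (Nat.pos_of_ne_zero (NeZero.ne m))
    (Nat.pos_of_ne_zero (NeZero.ne n))
  have hmod : ∀ i, g (i % (m * n)) = g i := (show g.Periodic (m * n) from hper).map_mod_nat
  have hgs : ∀ i, 0 ≤ (g i).1 ∧ (g i).1 < m := fun i =>
    hstrip _ ((hmem _).2 ⟨i % (m * n), Nat.mod_lt _ hN, hmod i⟩)
  let f : ℕ → StripSquare m := fun i =>
    (⟨(g i).1.toNat, by have := hgs i; omega⟩, (g i).2)
  have hfg : ∀ i, (((f i).1 : ℕ) : ℤ) = (g i).1 := fun i => Int.toNat_of_nonneg (hgs i).1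
  have hf : ∀ i, (stripGraph m).Adj (f i) (f (i + 1)) := fun i => by
    simpa only [stripGraph, hfg, Knight] using hg i
  have hcov : ∀ p : StripSquare m, ∃ i t, f t = shift n i p := fun p => by
    obtain ⟨i, hi⟩ := h.covers (p.1, p.2) (by simp) (by simp)
    obtain ⟨t, -, ht⟩ := (hmem _).1 hi
    refine ⟨i, t, Prod.ext (Fin.ext ?_) ?_⟩
    · zify
      rw [hfg, ht]
      by_cases he : Even i <;> simp [glide, shift, he, Fin.val_rev]
      have := p.1.2
      omega
    · change (g t).2 = _
      rw [ht]
      rfl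
  have hfper : ∀ i, f (i + m * n) = f i := fun i => by simp only [f, hper]
  have hfmod : ∀ i, f (i % (m * n)) = f i := (show f.Periodic (m * n) from hfper).map_mod_nat
  obtain ⟨i₀, t₀, h0⟩ := hcov (baseSquare m n).lift
  refine ⟨fun t => shift n (-i₀) (f (t + t₀)), ?_, ?_, ?_, ?_⟩
  · simp only [zero_add]
    rw [h0, shift_shift, neg_add_cancel, shift_zero]
  · simp only [zero_add]
    rw [add_comm, hfper]
  · intro i _
    rw [add_right_comm]
    exact adj_shift (hf _)
  · intro v
    obtain ⟨i, t, ht⟩ := hcov v.lift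
    refine ⟨(t + (m * n - t₀ % (m * n))) % (m * n), Nat.mod_lt _ hN, ?_⟩
    have h1 : f ((t + (m * n - t₀ % (m * n))) % (m * n) + t₀) = f t := by
      rw [← hfmod, Nat.mod_add_mod, ← hfmod t, ← Nat.add_mod_mod]
      have h2 : t + (m * n - t₀ % (m * n)) + t₀ % (m * n) = t + m * n := by
        have := Nat.mod_lt t₀ hN
        omega
      rw [h2, Nat.add_mod_right]
    rw [proj_shift, h1, ht, proj_shift, proj_lift]

end MobiusKnight

namespace MobiusKnight

/-! ### The small boards -/

/-- Width 3 cannot be widened, having no room for two disjoint borders, so its seeds use `w = 0` and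
no pairs. -/
theorem isSeed_three_two : IsSeed 0 3 2 4 2
    [.single (2, 4), .single (0, 5), .single (1, 3), .single (2, 1), .single (0, 0),
      .single (1, 2)]
    [.single (0, 4), .single (2, 5), .single (1, 7), .single (2, 9), .single (0, 8),
      .single (1, 10)]
    [.single (2, 12), .single (0, 13), .single (1, 11), .single (0, 9), .single (2, 8),
      .single (1, 6)]
    (2, 4) (1, 2) (0, 4) (1, 6) := by
  decide +kernel

theorem isSeed_three_eight : IsSeed 0 3 8 4 1
    [.single (2, 9), .single (1, 11), .single (0, 9), .single (2, 10), .single (1, 8),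
      .single (2, 6), .single (0, 5), .single (1, 7), .single (2, 5), .single (0, 4),
      .single (2, 3), .single (1, 5), .single (2, 7), .single (0, 6), .single (1, 4),
      .single (2, 2), .single (0, 3), .single (1, 1), .single (2, -1), .single (0, 0),
      .single (1, 2), .single (2, 4), .single (1, 6), .single (0, 8)]
    [.single (1, 10), .single (2, 8), .single (0, 7), .single (1, 9), .single (2, 11),
      .single (0, 12)]
    [.single (2, 13), .single (1, 15), .single (0, 13), .single (2, 14), .single (1, 12),
      .single (0, 10)]
    (2, 9) (0, 8) (1, 10) (0, 10) := by
  decide +kernel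

theorem isSeed_four_four : IsSeed 2 4 4 4 2
    [.pair (3, 3) (2, 1), .pair (3, -1) (2, -3), .pair (0, -4) (1, -2), .pair (3, -3) (2, -5),
      .pair (0, -6) (1, -4), .pair (0, -2) (1, 0), .pair (3, 1) (2, -1), .pair (0, 0) (1, 2)]
    [.pair (0, 4) (1, 6), .pair (3, 5) (2, 3), .pair (0, 2) (1, 4), .pair (0, 6) (1, 8),
      .pair (3, 9) (2, 7), .pair (0, 8) (1, 10)]
    [.pair (3, 11) (2, 9), .pair (3, 7) (2, 5)]
    (3, 3) (1, 2) (0, 4) (2, 5) := by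
  decide +kernel

theorem isSeed_four_six : IsSeed 2 4 6 4 2
    [.pair (3, 3) (2, 1), .pair (3, -1) (2, -3), .pair (3, -5) (2, -7), .pair (0, -8) (1, -6),
      .pair (3, -7) (2, -9), .pair (3, -11) (2, -13), .pair (0, -14) (1, -12),
      .pair (0, -10) (1, -8), .pair (0, -6) (1, -4), .pair (3, -3) (2, -5), .pair (0, -4) (1, -2),
      .pair (0, 0) (1, 2)]
    [.pair (3, 1) (2, -1), .pair (0, -2) (1, 0), .pair (0, 2) (1, 4), .pair (3, 5) (2, 3),
      .pair (0, 4) (1, 6), .pair (0, 8) (1, 10)]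
    [.pair (3, 11) (2, 9), .pair (3, 7) (2, 5)]
    (3, 3) (1, 2) (3, 1) (2, 5) := by
  decide +kernel

theorem isSeed_five_two : IsSeed 2 5 2 4 1
    [.pair (3, 3) (4, 5), .single (2, 6), .pair (4, 7) (3, 5), .pair (1, 4) (0, 2), .single (2, 1),
      .pair (0, 0) (1, 2)]
    [.pair (0, 4) (1, 6)]
    [.pair (3, 7) (4, 9), .single (2, 8), .pair (0, 7) (1, 5), .pair (3, 4) (4, 2), .single (2, 3),
      .pair (4, 4) (3, 6), .pair (1, 7) (0, 9), .single (2, 10), .pair (4, 11) (3, 9),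
      .pair (1, 8) (0, 6), .single (2, 5)]
    (3, 3) (1, 2) (0, 4) (2, 5) := by
  decide +kernel

theorem isSeed_five_four : IsSeed 2 5 4 4 1
    [.pair (3, 2) (4, 0), .single (2, 1), .pair (3, 3) (4, 1), .pair (3, -1) (4, -3),
      .single (2, -2), .pair (4, -1) (3, 1), .pair (4, 3) (3, 5), .pair (1, 4) (0, 2),
      .pair (1, 0) (0, -2), .single (2, -1), .pair (0, 0) (1, 2), .single (2, 4)]
    [.pair (4, 5) (3, 7), .pair (1, 6) (0, 4), .single (2, 5), .pair (0, 6) (1, 8),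
      .pair (3, 9) (4, 7), .single (2, 8)]
    [.pair (3, 6) (4, 4), .single (2, 3), .pair (4, 2) (3, 4), .pair (1, 5) (0, 3), .single (2, 2),
      .pair (0, 1) (1, 3)]
    (3, 2) (2, 4) (4, 5) (1, 3) := by
  decide +kernel

theorem isSeed_six_two : IsSeed 2 6 2 1 1
    [.pair (4, -1) (5, 1), .single (3, 0), .pair (5, -1) (4, -3), .single (3, -1),
      .pair (5, 0) (4, -2), .single (2, -1), .pair (0, 0) (1, -2), .single (2, 0)]
    [.pair (0, 1) (1, -1), .single (2, 1)]
    [.pair (4, 0) (5, 2), .single (3, 1)]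
    (4, -1) (2, 0) (0, 1) (3, 1) := by
  decide +kernel

theorem isSeed_seven_two : IsSeed 2 7 2 2 1
    [.single (3, 2), .pair (1, 3) (0, 1), .single (2, 2), .pair (0, 3) (1, 5), .single (2, 3),
      .pair (0, 2) (1, 4), .single (3, 3), .single (2, 1), .pair (0, 0) (1, 2), .single (2, 4)]
    [.single (4, 3), .pair (6, 2) (5, 4), .single (3, 5), .pair (1, 6) (0, 4), .single (2, 5),
      .pair (1, 7) (0, 5), .single (2, 6)]
    [.single (3, 4), .pair (5, 5) (6, 3), .single (4, 4)]
    (3, 2) (2, 4) (4, 3) (4, 4) := by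
  decide +kernel

theorem isSeed_eight_one : IsSeed 2 8 1 2 1
    [.single (2, 4), .pair (0, 5) (1, 3), .single (3, 4), .single (4, 2), .single (2, 1),
      .pair (0, 0) (1, 2)]
    [.single (3, 3), .single (4, 5), .pair (6, 4) (7, 6), .single (5, 5), .pair (6, 3) (7, 1),
      .single (5, 2), .single (4, 4), .single (2, 3), .pair (0, 2) (1, 4)]
    [.single (2, 6), .pair (0, 7) (1, 5), .single (3, 6)]
    (2, 4) (1, 2) (3, 3) (3, 6) := by
  decide +kernel

theorem isPieceTour_four_two : IsPieceTour 2 4 2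
    [.pair (0, 0) (1, 2), .pair (3, 3) (2, 1), .pair (0, 2) (1, 0), .pair (3, 1) (2, -1)] where
  valid := by decide +kernel
  closed := ⟨(0, 0), (2, -1), by decide +kernel, by decide +kernel⟩
  length := rfl
  covers := exists_glide_mem_of_rectangle (by norm_num) (B := 17) (by decide +kernel)
  pairs := rfl

theorem isPieceTour_six_one : IsPieceTour 2 6 1
    [.pair (0, 0) (1, 2), .single (2, 4), .pair (0, 5) (1, 3), .single (2, 1)] where
  valid := by decide +kernel
  closed := ⟨(0, 0), (2, 1), by decide +kernel, by decide +kernel⟩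
  length := rfl
  covers := exists_glide_mem_of_rectangle (by norm_num) (B := 17) (by decide +kernel)
  pairs := rfl

/-! ### The main theorem -/

theorem IsPieceTour.widen_iterate {m n : ℕ} {T : List Piece} (h : IsPieceTour 2 m n T) (hm : 4 ≤ m)
    (t : ℕ) : ∃ T', IsPieceTour 2 (m + 4 * t) n T' := by
  induction t with
  | zero => exact ⟨T, h⟩
  | succ t ih =>
    obtain ⟨T', h'⟩ := ih
    exact ⟨_, h'.widen (by omega)⟩

/-- Both residues of `n` modulo 4 proceed in steps of 4; since `n = 4` is impossible, the multiples
of 4 start at 8. -/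
theorem exists_isPieceTour_of_width_three {n : ℕ} (hn : 0 < n) (he : Even n) (h4 : n ≠ 4) :
    ∃ T, IsPieceTour 0 3 n T := by
  obtain ⟨r, rfl⟩ := he.two_dvd
  obtain ⟨j, rfl | rfl⟩ := Nat.even_or_odd' r
  · obtain ⟨i, rfl⟩ : ∃ i, j = i + 2 := ⟨j - 2, by omega⟩
    have h := isSeed_three_eight.isPieceTour (by norm_num) (by norm_num) (by norm_num) i
    rw [show 8 + i * 4 = 2 * (2 * (i + 2)) by ring] at h
    exact ⟨_, h⟩
  · have h := isSeed_three_two.isPieceTour (by norm_num) (by norm_num) (by norm_num) j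
    rw [show 2 + j * 4 = 2 * (2 * j + 1) by ring] at h
    exact ⟨_, h⟩

theorem exists_isPieceTour_of_width_four {n : ℕ} (hn : 0 < n) (he : Even n) :
    ∃ T, IsPieceTour 2 4 n T := by
  obtain ⟨r, rfl⟩ := he.two_dvd
  obtain ⟨j, rfl | rfl⟩ := Nat.even_or_odd' r
  · obtain ⟨i, rfl⟩ : ∃ i, j = i + 1 := ⟨j - 1, by omega⟩
    have h := isSeed_four_four.isPieceTour (by norm_num) (by norm_num) (by norm_num) i
    rw [show 4 + i * 4 = 2 * (2 * (i + 1)) by ring] at h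
    exact ⟨_, h⟩
  · rcases j with _ | i
    · exact ⟨_, isPieceTour_four_two⟩
    · have h := isSeed_four_six.isPieceTour (by norm_num) (by norm_num) (by norm_num) i
      rw [show 6 + i * 4 = 2 * (2 * (i + 1) + 1) by ring] at h
      exact ⟨_, h⟩

theorem exists_isPieceTour_of_width_five {n : ℕ} (hn : 0 < n) (he : Even n) :
    ∃ T, IsPieceTour 2 5 n T := by
  obtain ⟨r, rfl⟩ := he.two_dvd
  obtain ⟨j, rfl | rfl⟩ := Nat.even_or_odd' r
  · obtain ⟨i, rfl⟩ : ∃ i, j = i + 1 := ⟨j - 1, by omega⟩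
    have h := isSeed_five_four.isPieceTour (by norm_num) (by norm_num) (by norm_num) i
    rw [show 4 + i * 4 = 2 * (2 * (i + 1)) by ring] at h
    exact ⟨_, h⟩
  · have h := isSeed_five_two.isPieceTour (by norm_num) (by norm_num) (by norm_num) j
    rw [show 2 + j * 4 = 2 * (2 * j + 1) by ring] at h
    exact ⟨_, h⟩

theorem exists_isPieceTour_of_width_six {n : ℕ} (hn : 0 < n) : ∃ T, IsPieceTour 2 6 n T := by
  rcases n with _ | _ | i
  · omega
  · exact ⟨_, isPieceTour_six_one⟩
  · have h := isSeed_six_two.isPieceTour (by norm_num) (by norm_num) (by norm_num) i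
    rw [show 2 + i * 1 = i + 1 + 1 by ring] at h
    exact ⟨_, h⟩

theorem exists_isPieceTour_of_width_seven {n : ℕ} (hn : 0 < n) (he : Even n) :
    ∃ T, IsPieceTour 2 7 n T := by
  obtain ⟨r, rfl⟩ := he.two_dvd
  obtain ⟨i, rfl⟩ : ∃ i, r = i + 1 := ⟨r - 1, by omega⟩
  have h := isSeed_seven_two.isPieceTour (by norm_num) (by norm_num) (by norm_num) i
  rw [show 2 + i * 2 = 2 * (i + 1) by ring] at h
  exact ⟨_, h⟩

theorem exists_isPieceTour_of_width_eight {n : ℕ} (ho : Odd n) : ∃ T, IsPieceTour 2 8 n T := by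
  obtain ⟨i, rfl⟩ := ho
  have h := isSeed_eight_one.isPieceTour (by norm_num) (by norm_num) (by norm_num) i
  rw [show 1 + i * 2 = 2 * i + 1 by ring] at h
  exact ⟨_, h⟩

/-- Widening preserves `m` modulo 4, so widths 4 to 7 suffice as bases, except when 4 divides `m`
and `n` is odd: width 4 then has no tour, and the base is 8. -/
theorem exists_isPieceTour {m n : ℕ} (hm : 3 ≤ m) (hn : 0 < n) (he : Even m ∨ Even n)
    (h34 : ¬ (m = 3 ∧ n = 4)) (h4 : ¬ (m = 4 ∧ Odd n)) :
    ∃ w T, w ≤ m ∧ IsPieceTour w m n T := by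
  rcases hm.eq_or_lt with rfl | hm
  · obtain ⟨T, hT⟩ := exists_isPieceTour_of_width_three hn
      (he.resolve_left (by decide)) (fun h => h34 ⟨rfl, h⟩)
    exact ⟨0, T, by omega, hT⟩
  have hmod := Nat.div_add_mod m 4
  have hlt := Nat.mod_lt m (show 4 > 0 by norm_num)
  have hmo : m % 2 = 1 → Even n := fun h => he.resolve_left fun h' => by
    rw [Nat.even_iff] at h'
    omega
  have key : ∀ b, 4 ≤ b → b ≤ m → b % 4 = m % 4 → (∃ T, IsPieceTour 2 b n T) →
      ∃ w T, w ≤ m ∧ IsPieceTour w m n T := by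
    rintro b hb hbm hbmod ⟨T, hT⟩
    obtain ⟨T', hT'⟩ := hT.widen_iterate hb ((m - b) / 4)
    rw [show b + 4 * ((m - b) / 4) = m by omega] at hT'
    exact ⟨2, T', by omega, hT'⟩
  obtain h | h | h | h : m % 4 = 0 ∨ m % 4 = 1 ∨ m % 4 = 2 ∨ m % 4 = 3 := by omega
  · rcases Nat.even_or_odd n with hn' | hn'
    · exact key 4 le_rfl hm (by omega) (exists_isPieceTour_of_width_four hn hn')
    · have : m ≠ 4 := fun h => h4 ⟨h, hn'⟩
      exact key 8 (by norm_num) (by omega) (by omega) (exists_isPieceTour_of_width_eight hn')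
  · exact key 5 (by norm_num) (by omega) (by omega)
      (exists_isPieceTour_of_width_five hn (hmo (by omega)))
  · exact key 6 (by norm_num) (by omega) (by omega) (exists_isPieceTour_of_width_six hn)
  · exact key 7 (by norm_num) (by omega) (by omega)
      (exists_isPieceTour_of_width_seven hn (hmo (by omega)))

/-- On the board with a single square the trivial path is a nullhomotopic tour. -/
theorem isNullhomotopicTour_nil :
    IsNullhomotopicTour (Quiver.Path.nil : Quiver.Path (baseSquare 1 1) (baseSquare 1 1)) := by
  refine ⟨⟨fun v => ?_, by simp, by simp [darts]⟩, (loopClass_eq_one_iff _).2 rfl⟩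
  have : v = baseSquare 1 1 := Square.ext (Subsingleton.elim _ _) (Subsingleton.elim _ _)
  simp [this]

end MobiusKnight

theorem theorem4p1 (m n : ℕ) [NeZero m] [NeZero n] :
    (∃ p : Quiver.Path (MobiusKnight.baseSquare m n) (MobiusKnight.baseSquare m n),
        MobiusKnight.IsNullhomotopicTour p) ↔
      ¬ ((Odd m ∧ Odd n ∧ (1 < m ∨ 1 < n)) ∨
        (m = 1 ∧ 1 < n) ∨
        m = 2 ∨
        (m = 3 ∧ n = 4) ∨
        (m = 4 ∧ Odd n)) := by
  refine ⟨fun h hmn => MobiusKnight.not_exists_tour hmn h, fun h => ?_⟩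
  have hm : 0 < m := Nat.pos_of_ne_zero (NeZero.ne m)
  have hn : 0 < n := Nat.pos_of_ne_zero (NeZero.ne n)
  push Not at h
  obtain ⟨h1, h2, h3, h4, h5⟩ := h
  by_cases hm1 : m = 1
  · have hn1 : n = 1 := le_antisymm (h2 hm1) hn
    subst hm1 hn1
    exact ⟨_, MobiusKnight.isNullhomotopicTour_nil⟩
  have hm3 : 3 ≤ m := by omega
  have he : Even m ∨ Even n := by
    by_contra! ho
    rw [Nat.not_even_iff_odd, Nat.not_even_iff_odd] at ho
    have := (h1 ho.1 ho.2).1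
    omega
  obtain ⟨w, T, hw, hT⟩ := MobiusKnight.exists_isPieceTour hm3 hn he (fun h => h4 h.1 h.2)
    (fun h => h5 h.1 h.2)
  obtain ⟨f, hf⟩ := hT.exists_isLiftedTour hw
  exact hf.exists_isNullhomotopicTour (by nlinarith)
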